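/- All spaces are finite dimensional and complex, $\mathbb{C}^m\otimes\mathbb{C}^n=\mathcal H_A\otimes\mathcal H_B$, and $|i,j\rangle$ is the product of computational basis vectors (numbered from $0$). For $k\le n$ we regard $\mathbb{C}^m\otimes\mathbb{C}^k$ as a subspace of $\mathbb{C}^m\otimes\mathbb{C}^n$ in the standard way. A subspace $V\subseteq\mathbb{C}^m\otimes\mathbb{C}^n$ is an \emph{entanglement-breaking (EB) space} if for all systems $a,b$ and every $|\Psi\rangle\in V\otimes\mathcal H_{ab}$ the operator $\mathrm{Tr}_B|\Psi\rangle\langle\Psi|$ is separable with respect to $A:ab$, i.e. of the form $\sum_s q_s|\mu_s\rangle\langle\mu_s|_A\otimes|\nu_s\rangle\langle\nu_s|_{ab}$ with $q_s\ge0$ (finite sum). $V$ is \emph{EB convertible} to $V'$ if $V'=(W\otimes U)V$ for some (possibly rectangular) matrix $W$ and some unitary $U$; $V$ and $V'$ are \emph{EB equivalent} if moreover $W$ can be chosen invertible. Two subspaces $S,T$ of $\mathbb{C}^m\otimes\mathbb{C}^n$ of equal dimension are \emph{LU equivalent} if a product unitary $U_A\otimes U_B$ maps every vector of $S$ into $T$.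 The \emph{$B$-rank} of $V$ is the dimension of the smallest subspace $S\subseteq\mathbb{C}^n$ with $V\subseteq\mathbb{C}^m\otimes S$. (1) Every $2$-dimensional EB subspace $V\subseteq\mathbb{C}^2\otimes\mathbb{C}^n$ is LU equivalent to an EB subspace $T$ of $\mathbb{C}^2\otimes\mathbb{C}^k$ of $B$-rank $k$, for some $k\in\{2,3,4\}$ with $k\le n$. (2) Let $k\in\{2,3\}$ and let $T\subseteq\mathbb{C}^2\otimes\mathbb{C}^k\subseteq\mathbb{C}^2\otimes\mathbb{C}^3$ be a $2$-dimensional subspace. Then $T$ is an EB space if and only if one of the following subspaces of $\mathbb{C}^3\otimes\mathbb{C}^3$ is EB convertible to $T$ (regarded in $\mathbb{C}^2\otimes\mathbb{C}^3$): $$\mathrm{span}\{|0,0\rangle,\ |1,1\rangle+|2,2\rangle\},\qquad \mathrm{span}\{|0,0\rangle+|1,1\rangle,\ |1,1\rangle+|2,2\rangle\},$$ $$\mathrm{span}\{|0,0\rangle+|1,1\rangle,\ |0,1\rangle+|1\rangle(d|0\rangle+fe^{i\theta}|1\rangle+g|2\rangle)\},$$ where $g>0$ and $d,f,\theta\ge0$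 are real numbers with $-1-f^2+g^2-d^2(-2+d^2+f^2+g^2)+2df^2\cos2\theta\ge0$. (3) Let $T\subseteq\mathbb{C}^2\otimes\mathbb{C}^4$ be a subspace. Then $T$ is a $2$-dimensional EB space of $B$-rank $4$ if and only if $T$ is EB equivalent to the span of the two vectors $$|0,0\rangle+b_0(a_0|0\rangle+a_1|1\rangle)|2\rangle+d_0(c_0|0\rangle+c_1|1\rangle)|3\rangle,$$ $$|1,1\rangle+b_1(a_0|0\rangle+a_1|1\rangle)|2\rangle+d_1(c_0|0\rangle+c_1|1\rangle)|3\rangle$$ for some complex numbers $a_j,b_j,c_j,d_j$ ($j=0,1$) with $$\det\begin{bmatrix}a_0b_1&a_1b_0\\c_0d_1&c_1d_0\end{bmatrix}\ne0.$$ -/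

import Mathlib

open scoped Matrix Kronecker

noncomputable section

namespace EBSpace

/-- The vector space `ℂ^m ⊗ ℂ^n` (system `A` first, system `B` second), in coordinates. -/
abbrev Bip (m n : ℕ) : Type := Fin m × Fin n → ℂ

/-- The computational product basis vector `|i, j⟩`. -/
def ket {m n : ℕ} (i : Fin m) (j : Fin n) : Bip m n := Pi.single (i, j) 1

/-- The (unnormalized) rank-one operator `|v⟩⟨v|`. -/
def proj {ι : Type*} (v : ι → ℂ) : Matrix ι ι ℂ := Matrix.vecMulVec v (star v)

/-- `V ⊗ ℂ^κ`, as the span of the product vectors `v ⊗ w` with `v ∈ V`. -/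
def tensorRight {ι κ : Type*} (V : Submodule ℂ (ι → ℂ)) : Submodule ℂ (ι × κ → ℂ) :=
  Submodule.span ℂ {Ψ | ∃ v ∈ V, ∃ w : κ → ℂ, Ψ = fun x => v x.1 * w x.2}

/-- A vector lies in `V ⊗ ℂ^κ` iff all its slices lie in `V`. -/
theorem mem_tensorRight_iff {ι κ : Type*} [Fintype κ] [DecidableEq κ]
    (V : Submodule ℂ (ι → ℂ)) (Ψ : ι × κ → ℂ) :
    Ψ ∈ tensorRight V ↔ ∀ k, (fun i => Ψ (i, k)) ∈ V := by
  constructor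
  · intro h k
    induction h using Submodule.span_induction with
    | mem x hx =>
      obtain ⟨v, hv, w, rfl⟩ := hx
      have := V.smul_mem (w k) hv
      convert this using 1
      ext i
      simp [mul_comm]
    | zero => exact V.zero_mem
    | add x y _ _ hx hy => exact V.add_mem hx hy
    | smul c x _ hx => exact V.smul_mem c hx
  · intro h
    have hsum : Ψ = ∑ k, fun x : ι × κ => Ψ (x.1, k) * (Pi.single k (1 : ℂ) : κ → ℂ) x.2 := by
      ext ⟨i, k⟩
      simp [Finset.sum_apply, Pi.single_apply]
    rw [hsum]
    exact Submodule.sum_mem _ fun k _ => Submodule.subset_span ⟨_, h k, _, rfl⟩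

/-- The partial trace over the middle system `B` of an operator on `(A ⊗ B) ⊗ C`;
the result is an operator on `A ⊗ C`. -/
def traceB {α β γ : Type*} [Fintype β] (M : Matrix ((α × β) × γ) ((α × β) × γ) ℂ) :
    Matrix (α × γ) (α × γ) ℂ :=
  Matrix.of fun x y => ∑ j, M ((x.1, j), x.2) ((y.1, j), y.2)

/-- Separability of a bipartite (not necessarily normalized) positive operator:
it is a finite sum `∑ qₙ |μₙ⟩⟨μₙ| ⊗ |νₙ⟩⟨νₙ|` with `qₙ ≥ 0`. -/
def IsSeparable {α γ : Type*} (ρ : Matrix (α × γ) (α × γ) ℂ) : Prop :=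
  ∃ (N : ℕ) (q : Fin N → ℝ) (μ : Fin N → α → ℂ) (ν : Fin N → γ → ℂ),
    (∀ s, 0 ≤ q s) ∧ ρ = ∑ s, (q s : ℂ) • (proj (μ s) ⊗ₖ proj (ν s))

/-- `V ⊆ ℂ^m ⊗ ℂ^n` is an entanglement-breaking space: for all systems `a = ℂ^p`, `b = ℂ^q`
and every `Ψ ∈ V ⊗ (a ⊗ b)`, tracing out `B` leaves a state separable between `A` and `ab`.
Vectors are not normalized; separability as defined above is insensitive to scaling. -/
def IsEB {m n : ℕ} (V : Submodule ℂ (Bip m n)) : Prop :=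
  ∀ (p q : ℕ) (Ψ : (Fin m × Fin n) × (Fin p × Fin q) → ℂ),
    Ψ ∈ tensorRight V → IsSeparable (traceB (proj Ψ))

/-- The image of `V` under the product operator `W ⊗ U`. -/
def image {m m' n n' : ℕ} (W : Matrix (Fin m') (Fin m) ℂ) (U : Matrix (Fin n') (Fin n) ℂ)
    (V : Submodule ℂ (Bip m n)) : Submodule ℂ (Bip m' n') :=
  V.map (W ⊗ₖ U).mulVecLin

/-- `V` is EB-convertible to `V'`: `V' = (W ⊗ U) V` for a matrix `W` and a unitary `U`. -/
def EBConvertible {m m' n : ℕ} (V : Submodule ℂ (Bip m n)) (V' : Submodule ℂ (Bip m' n)) :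
    Prop :=
  ∃ (W : Matrix (Fin m') (Fin m) ℂ) (U : Matrix (Fin n) (Fin n) ℂ),
    U ∈ Matrix.unitaryGroup (Fin n) ℂ ∧ V' = image W U V

/-- `V` and `V'` are EB-equivalent: `V' = (W ⊗ U) V` with `W` invertible and `U` unitary. -/
def EBEquivalent {m n : ℕ} (V V' : Submodule ℂ (Bip m n)) : Prop :=
  ∃ (W : Matrix (Fin m) (Fin m) ℂ) (U : Matrix (Fin n) (Fin n) ℂ),
    IsUnit W ∧ U ∈ Matrix.unitaryGroup (Fin n) ℂ ∧ V' = image W U V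

/-- `S` and `T` are LU equivalent: they have the same dimension and a product unitary maps
every vector of `S` into `T`. -/
def LUEquivalent {m n : ℕ} (S T : Submodule ℂ (Bip m n)) : Prop :=
  Module.finrank ℂ S = Module.finrank ℂ T ∧
  ∃ (W : Matrix (Fin m) (Fin m) ℂ) (U : Matrix (Fin n) (Fin n) ℂ),
    W ∈ Matrix.unitaryGroup (Fin m) ℂ ∧ U ∈ Matrix.unitaryGroup (Fin n) ℂ ∧
    ∀ a ∈ S, (W ⊗ₖ U) *ᵥ a ∈ T

/-- The inclusion `ℂ^m ⊗ ℂ^k ⊆ ℂ^m ⊗ ℂ^n` for `k ≤ n`, `|i, j⟩ ↦ |i, j⟩`. -/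
def embedB {m k n : ℕ} (_hk : k ≤ n) : Bip m k →ₗ[ℂ] Bip m n where
  toFun v x := if h : (x.2 : ℕ) < k then v (x.1, ⟨x.2, h⟩) else 0
  map_add' v w := by
    ext x
    by_cases h : (x.2 : ℕ) < k <;> simp [h]
  map_smul' c v := by
    ext x
    by_cases h : (x.2 : ℕ) < k <;> simp [h]

/-- The inclusion sends product basis vectors to product basis vectors. -/
theorem embedB_ket {m k n : ℕ} (hk : k ≤ n) (i : Fin m) (j : Fin k) :
    embedB hk (ket i j) = ket i (Fin.castLE hk j) := by
  ext ⟨a, b⟩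
  by_cases h : (b : ℕ) < k
  · simp [embedB, ket, Pi.single_apply, h, Fin.ext_iff]
  · have : (b : ℕ) ≠ j := by omega
    simp [embedB, ket, h, Fin.ext_iff, this]

/-- The local support of `V` on system `B`: the smallest subspace `S ⊆ ℂ^n` such that
`V ⊆ ℂ^m ⊗ S`. -/
def supportB {m n : ℕ} (V : Submodule ℂ (Bip m n)) : Submodule ℂ (Fin n → ℂ) :=
  Submodule.span ℂ {w | ∃ v ∈ V, ∃ i, w = fun j => v (i, j)}

/-- The local rank of `V` on system `B`. -/
def rankB {m n : ℕ} (V : Submodule ℂ (Bip m n)) : ℕ := Module.finrank ℂ (supportB V)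

/-- The three kinds of two-dimensional model spaces in `ℂ^3 ⊗ ℂ^3`. -/
def IsModel3 (S : Submodule ℂ (Bip 3 3)) : Prop :=
  S = Submodule.span ℂ {ket 0 0, ket 1 1 + ket 2 2} ∨
  S = Submodule.span ℂ {ket 0 0 + ket 1 1, ket 1 1 + ket 2 2} ∨
  ∃ d f θ g : ℝ, 0 ≤ d ∧ 0 ≤ f ∧ 0 ≤ θ ∧ 0 < g ∧
    0 ≤ -1 - f ^ 2 + g ^ 2 - d ^ 2 * (-2 + d ^ 2 + f ^ 2 + g ^ 2)
      + 2 * d * f ^ 2 * Real.cos (2 * θ) ∧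
    S = Submodule.span ℂ
      {ket 0 0 + ket 1 1,
       ket 0 1 + ((d : ℂ) • ket 1 0 + ((f : ℂ) * Complex.exp (Complex.I * (θ : ℂ))) • ket 1 1
        + (g : ℂ) • ket 1 2)}

/-- The model space in `ℂ^2 ⊗ ℂ^4` spanned by
`|j,j⟩ + b_j (a_0|0⟩ + a_1|1⟩)|2⟩ + d_j (c_0|0⟩ + c_1|1⟩)|3⟩` for `j = 0, 1`. -/
def model4 (a b c d : Fin 2 → ℂ) : Submodule ℂ (Bip 2 4) :=
  Submodule.span ℂ
    {ket 0 0 + b 0 • (a 0 • ket 0 2 + a 1 • ket 1 2) + d 0 • (c 0 • ket 0 3 + c 1 • ket 1 3),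
     ket 1 1 + b 1 • (a 0 • ket 0 2 + a 1 • ket 1 2) + d 1 • (c 0 • ket 0 3 + c 1 • ket 1 3)}

end EBSpace

end

/-!
A subspace `V` of `ℂ^m ⊗ ℂ^n` of dimension `r` is encoded by `n` slices `M j`, the `m × r` matrices
formed by the components on `|j⟩_B` of a basis of `V`. In this encoding `V` is entanglement breaking
if and only if the operator `∑ |M j⟩⟨M j|` is separable. A unitary on `B` mixes the slices and
preserves this operator, a matrix `W` on `A` multiplies the slices from the left, and a change of
basis of `V` multiplies them from the right. The `B`-rank is the dimension of the span of the
slices.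

For `2 × 2` slices we use Wootters' argument. By the Autonne–Takagi factorization, a unitary mix
diagonalizes the Gram matrix of the slices for the polarized determinant, and in a decomposition
into product vectors every term closes up a polygon; hence, when `∑ |M j⟩⟨M j|` is separable, the
diagonal entries satisfy the polygon inequalities. If there are four slices, or three slices with
singular Gram matrix, these inequalities allow a second mix after which all slices have rank one,
and rank-one slices are brought to the diagonal model spaces or to `model4`.

If there are three slices and the Gram matrix is invertible, some invertible matrix on the right
makes all slices symmetric, and a unitary triangularizes them to those of the third model space.
There the partial transpose has a determinant equal to the left-hand side of the inequality. If it
is nonnegative, the operator is a sum of tensor squares `H ⊗ H` of Hermitian matrices with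
`∑ det H = 0`; rotating pairs with determinants of opposite sign makes every `H` singular, which
is a separable decomposition.
-/

namespace EBSpace

section Slices

variable {α β γ δ ι κ : Type*}

/-- The family of the linear combinations of `M` whose coefficients are the rows of `U`. -/
def mix {E : Type*} [AddCommMonoid E] [Module ℂ E] [Fintype ι] (U : Matrix κ ι ℂ) (M : ι → E) :
    κ → E :=
  fun j => ∑ k, U j k • M k

/-- The matrix whose rows are the entries of the slices `M j`. -/
def sliceMatrix (M : ι → Matrix α β ℂ) : Matrix ι (α × β) ℂ :=
  Matrix.of fun j x => M j x.1 x.2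

/-- The operator `∑ |M j⟩⟨M j|`, where a slice `M j` is read as a vector of `ℂ^α ⊗ ℂ^β`. -/
def slicesState [Fintype ι] (M : ι → Matrix α β ℂ) : Matrix (α × β) (α × β) ℂ :=
  (sliceMatrix M)ᵀ * (sliceMatrix M)ᵀᴴ

/-- The vector `∑ M j a c |a, j⟩` formed by the `c`-th columns of the slices `M j`. -/
def sliceCol {m n : ℕ} (M : Fin n → Matrix (Fin m) β ℂ) (c : β) : Bip m n :=
  fun x => M x.2 x.1 c

/-- The subspace of `ℂ^m ⊗ ℂ^n` encoded by the slices `M j`, one for each basis vector of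
system `B`: it is spanned by one vector for every column index. -/
def ofSlices {m n : ℕ} (M : Fin n → Matrix (Fin m) β ℂ) : Submodule ℂ (Bip m n) :=
  Submodule.span ℂ (Set.range (sliceCol M))

section Mix

variable {E : Type*} [AddCommGroup E] [Module ℂ E] [Fintype ι] [Fintype κ]

theorem mix_mix {l : Type*} (U : Matrix l κ ℂ) (U' : Matrix κ ι ℂ) (M : ι → E) :
    mix U (mix U' M) = mix (U * U') M := by
  funext j
  simp only [mix, Matrix.mul_apply, Finset.smul_sum, Finset.sum_smul, smul_smul]
  exact Finset.sum_comm

theorem mix_one [DecidableEq ι] (M : ι → E) : mix 1 M = M := by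
  funext j
  simp [mix, Matrix.one_apply]

theorem span_range_mix_le {l : Type*} (U : Matrix l ι ℂ) (M : ι → E) :
    Submodule.span ℂ (Set.range (mix U M)) ≤ Submodule.span ℂ (Set.range M) := by
  rw [Submodule.span_le]
  rintro _ ⟨j, rfl⟩
  exact Submodule.sum_mem _ fun k _ => Submodule.smul_mem _ _ (Submodule.subset_span ⟨k, rfl⟩)

theorem span_range_mix [DecidableEq ι] {U : Matrix ι ι ℂ} (hU : IsUnit U.det) (M : ι → E) :
    Submodule.span ℂ (Set.range (mix U M)) = Submodule.span ℂ (Set.range M) := by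
  refine (span_range_mix_le U M).antisymm ?_
  calc Submodule.span ℂ (Set.range M)
      = Submodule.span ℂ (Set.range (mix U⁻¹ (mix U M))) := by
        rw [mix_mix, Matrix.nonsing_inv_mul _ hU, mix_one]
    _ ≤ Submodule.span ℂ (Set.range (mix U M)) := span_range_mix_le _ _

end Mix

theorem mix_apply [Fintype ι] (U : Matrix κ ι ℂ) (M : ι → Matrix α β ℂ) (j : κ) (a : α) (c : β) :
    mix U M j a c = ∑ k, U j k * M k a c := by
  simp [mix, Matrix.sum_apply]

theorem mix_mul [Fintype ι] [Fintype β] (R : Matrix β γ ℂ) (U : Matrix κ ι ℂ)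
    (M : ι → Matrix α β ℂ) (j : κ) : mix U (fun k => M k * R) j = mix U M j * R := by
  simp [mix, Matrix.sum_mul]

theorem sliceMatrix_mix [Fintype ι] (U : Matrix κ ι ℂ) (M : ι → Matrix α β ℂ) :
    sliceMatrix (mix U M) = U * sliceMatrix M := by
  ext j x
  simp [sliceMatrix, mix_apply, Matrix.mul_apply]

theorem sliceMatrix_mul_mul [Fintype α] [Fintype β] (W : Matrix γ α ℂ) (R : Matrix β δ ℂ)
    (M : ι → Matrix α β ℂ) :
    sliceMatrix (fun j => W * M j * R) = sliceMatrix M * (W ⊗ₖ Rᵀ)ᵀ := by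
  ext j x
  simp only [sliceMatrix, Matrix.of_apply, Matrix.mul_apply, Matrix.transpose_apply,
    Matrix.kroneckerMap_apply, Fintype.sum_prod_type, Finset.sum_mul]
  rw [Finset.sum_comm]
  exact Finset.sum_congr rfl fun a _ => Finset.sum_congr rfl fun c _ => by ring

section SlicesState

variable [Fintype ι]

theorem slicesState_apply (M : ι → Matrix α β ℂ) (x y : α × β) :
    slicesState M x y = ∑ j, M j x.1 x.2 * star (M j y.1 y.2) := by
  simp [slicesState, sliceMatrix, Matrix.mul_apply]

theorem slicesState_comp_equiv [Fintype κ] (M : ι → Matrix α β ℂ) (e : κ ≃ ι) :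
    slicesState (fun j => M (e j)) = slicesState M := by
  ext x y
  simp only [slicesState_apply]
  exact e.sum_comp fun j => M j x.1 x.2 * star (M j y.1 y.2)

theorem slicesState_mix [DecidableEq ι] {U : Matrix ι ι ℂ} (hU : U ∈ Matrix.unitaryGroup ι ℂ)
    (M : ι → Matrix α β ℂ) : slicesState (mix U M) = slicesState M := by
  have hUT : Uᵀ * Uᵀᴴ = 1 :=
    Matrix.mem_unitaryGroup_iff.1 (Matrix.transpose_mem_unitaryGroup_iff.2 hU)
  rw [slicesState, slicesState, sliceMatrix_mix, Matrix.transpose_mul, Matrix.conjTranspose_mul,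
    Matrix.mul_assoc, ← Matrix.mul_assoc Uᵀ, hUT, Matrix.one_mul]

theorem slicesState_mul_mul [Fintype α] [Fintype β] (W : Matrix γ α ℂ) (R : Matrix β δ ℂ)
    (M : ι → Matrix α β ℂ) :
    slicesState (fun j => W * M j * R) = (W ⊗ₖ Rᵀ) * slicesState M * (W ⊗ₖ Rᵀ)ᴴ := by
  rw [slicesState, slicesState, sliceMatrix_mul_mul, Matrix.transpose_mul,
    Matrix.transpose_transpose, Matrix.conjTranspose_mul]
  simp only [Matrix.mul_assoc]

end SlicesState

end Slices

section OfSlices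

variable {m m' n n' r : ℕ}

theorem image_ofSlices {β : Type*} (W : Matrix (Fin m') (Fin m) ℂ) (U : Matrix (Fin n') (Fin n) ℂ)
    (M : Fin n → Matrix (Fin m) β ℂ) :
    image W U (ofSlices M) = ofSlices fun j => W * mix U M j := by
  rw [image, ofSlices, ofSlices, Submodule.map_span, ← Set.range_comp]
  congr 2
  ext c ⟨a, j⟩
  simp only [Function.comp, Matrix.mulVecLin_apply, Matrix.mulVec, dotProduct, sliceCol,
    Matrix.kroneckerMap_apply, Fintype.sum_prod_type, Matrix.mul_apply, mix_apply, Finset.mul_sum,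
    mul_assoc]

theorem image_image {m'' n'' : ℕ} (W' : Matrix (Fin m'') (Fin m') ℂ)
    (U' : Matrix (Fin n'') (Fin n') ℂ) (W : Matrix (Fin m') (Fin m) ℂ)
    (U : Matrix (Fin n') (Fin n) ℂ) (V : Submodule ℂ (Bip m n)) :
    image W' U' (image W U V) = image (W' * W) (U' * U) V := by
  rw [image, image, image, ← Submodule.map_comp, ← Matrix.mulVecLin_mul,
    Matrix.mul_kronecker_mul]

theorem image_one (V : Submodule ℂ (Bip m n)) : image 1 1 V = V := by
  simp [image]

theorem sliceCol_mul {β γ : Type*} [Fintype β] (M : Fin n → Matrix (Fin m) β ℂ)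
    (R : Matrix β γ ℂ) : sliceCol (fun j => M j * R) = mix Rᵀ (sliceCol M) := by
  ext c x
  simp [sliceCol, mix, Matrix.mul_apply, Finset.sum_apply, mul_comm]

theorem ofSlices_mul {β : Type*} [Fintype β] [DecidableEq β] (M : Fin n → Matrix (Fin m) β ℂ)
    {R : Matrix β β ℂ} (hR : IsUnit R.det) : ofSlices (fun j => M j * R) = ofSlices M := by
  rw [ofSlices, sliceCol_mul, span_range_mix (by rwa [Matrix.det_transpose]), ofSlices]

theorem exists_eq_ofSlices (V : Submodule ℂ (Bip m n)) (hV : Module.finrank ℂ V = r) :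
    ∃ M : Fin n → Matrix (Fin m) (Fin r) ℂ, V = ofSlices M ∧
      LinearIndependent ℂ (sliceCol M) := by
  let b := (Module.finBasis ℂ V).reindex (finCongr hV)
  refine ⟨fun j => Matrix.of fun a c => (b c : Bip m n) (a, j), ?_, ?_⟩
  · have hspan := congrArg (Submodule.map V.subtype) b.span_eq
    rw [Submodule.map_span, ← Set.range_comp, Submodule.map_top, Submodule.range_subtype] at hspan
    exact hspan.symm
  · exact b.linearIndependent.map' V.subtype (Submodule.ker_subtype V)

theorem finrank_ofSlices_eq_iff {M : Fin n → Matrix (Fin m) (Fin r) ℂ} :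
    Module.finrank ℂ (ofSlices M) = r ↔ LinearIndependent ℂ (sliceCol M) := by
  rw [linearIndependent_iff_card_eq_finrank_span, Fintype.card_fin]
  exact eq_comm

theorem embedB_injective {k : ℕ} (hk : k ≤ n) :
    Function.Injective (embedB hk : Bip m k →ₗ[ℂ] Bip m n) := by
  intro v w h
  ext ⟨a, j⟩
  simpa [embedB] using congrFun h (a, Fin.castLE hk j)

/-- The family `M` of length `k`, extended by zeros to length `n`. -/
def pad {E : Type*} [Zero E] {k : ℕ} (n : ℕ) (M : Fin k → E) : Fin n → E :=
  fun j => if h : (j : ℕ) < k then M ⟨j, h⟩ else 0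

theorem map_embedB_ofSlices {β : Type*} {k : ℕ} (hk : k ≤ n) (M : Fin k → Matrix (Fin m) β ℂ) :
    (ofSlices M).map (embedB hk) = ofSlices (pad n M) := by
  rw [ofSlices, ofSlices, Submodule.map_span, ← Set.range_comp]
  congr 2
  ext c ⟨a, j⟩
  by_cases h : (j : ℕ) < k <;> simp [embedB, sliceCol, pad, h]

theorem slicesState_pad {α β : Type*} {k : ℕ} (hk : k ≤ n) (M : Fin k → Matrix α β ℂ) :
    slicesState (pad n M) = slicesState M := by
  obtain ⟨l, rfl⟩ := Nat.exists_eq_add_of_le hk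
  ext x y
  simp [slicesState_apply, pad, Fin.sum_univ_add]

end OfSlices

section Separable

variable {α β γ δ ι : Type*}

theorem isSeparable_slicesState_vecMulVec [Fintype ι] (μ : ι → α → ℂ) (ν : ι → γ → ℂ) :
    IsSeparable (slicesState fun s => Matrix.vecMulVec (μ s) (ν s)) := by
  refine ⟨Fintype.card ι, 1, fun s => μ ((Fintype.equivFin ι).symm s),
    fun s => ν ((Fintype.equivFin ι).symm s), fun _ => zero_le_one, ?_⟩
  rw [← slicesState_comp_equiv _ (Fintype.equivFin ι).symm]
  ext x y
  simp only [slicesState_apply, Matrix.sum_apply]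
  refine Finset.sum_congr rfl fun s _ => ?_
  simp only [proj, Matrix.smul_apply, Matrix.kroneckerMap_apply, Matrix.vecMulVec_apply,
    Pi.star_apply, Pi.one_apply, smul_eq_mul, star_mul', Complex.ofReal_one]
  ring

theorem isSeparable_iff {ρ : Matrix (α × γ) (α × γ) ℂ} :
    IsSeparable ρ ↔ ∃ (N : ℕ) (μ : Fin N → α → ℂ) (ν : Fin N → γ → ℂ),
      ρ = slicesState fun s => Matrix.vecMulVec (μ s) (ν s) := by
  constructor
  · rintro ⟨N, q, μ, ν, hq, rfl⟩
    refine ⟨N, fun s => (Real.sqrt (q s) : ℂ) • μ s, ν, ?_⟩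
    ext x y
    rw [slicesState_apply, Matrix.sum_apply]
    refine Finset.sum_congr rfl fun s _ => ?_
    have hsqrt : (q s : ℂ) = (Real.sqrt (q s) : ℂ) * (Real.sqrt (q s) : ℂ) := by
      rw [← Complex.ofReal_mul, Real.mul_self_sqrt (hq s)]
    simp only [proj, Matrix.smul_apply, Matrix.kroneckerMap_apply, Matrix.vecMulVec_apply,
      Pi.star_apply, smul_eq_mul, Pi.smul_apply, star_mul', RCLike.star_def, Complex.conj_ofReal]
    rw [hsqrt]
    ring
  · rintro ⟨N, μ, ν, rfl⟩
    exact isSeparable_slicesState_vecMulVec μ ν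

theorem IsSeparable.slicesState_mul_mul [Fintype ι] [Fintype α] [Fintype β]
    {M : ι → Matrix α β ℂ} (hM : IsSeparable (slicesState M)) (W : Matrix γ α ℂ)
    (R : Matrix β δ ℂ) : IsSeparable (slicesState fun j => W * M j * R) := by
  obtain ⟨N, μ, ν, hN⟩ := isSeparable_iff.1 hM
  refine isSeparable_iff.2 ⟨N, fun s => W *ᵥ μ s, fun s => ν s ᵥ* R, ?_⟩
  simp only [EBSpace.slicesState_mul_mul, hN, ← Matrix.mul_vecMulVec, ← Matrix.vecMulVec_mul]

end Separable

section IsEB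

variable {m m' n r : ℕ}

theorem traceB_proj {α β γ : Type*} [Fintype β] (Ψ : (α × β) × γ → ℂ) :
    traceB (proj Ψ) = slicesState fun j => Matrix.of fun a k => Ψ ((a, j), k) := by
  ext x y
  simp [traceB, proj, slicesState_apply, Matrix.vecMulVec_apply]

theorem isEB_ofSlices {M : Fin n → Matrix (Fin m) (Fin r) ℂ} :
    IsEB (ofSlices M) ↔ IsSeparable (slicesState M) := by
  constructor
  · intro hEB
    have hsep := hEB r 1 (fun x => M x.1.2 x.1.1 x.2.1) <| (mem_tensorRight_iff _ _).2
      fun k => Submodule.subset_span ⟨k.1, rfl⟩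
    rw [traceB_proj] at hsep
    convert hsep.slicesState_mul_mul (1 : Matrix (Fin m) (Fin m) ℂ)
      ((1 : Matrix (Fin r) (Fin r) ℂ).submatrix Prod.fst id) using 2
    ext j a c
    simp [Matrix.mul_apply, Matrix.one_apply, Fintype.sum_prod_type]
  · intro hsep p q Ψ hΨ
    rw [mem_tensorRight_iff] at hΨ
    choose w hw using fun k => (Submodule.mem_span_range_iff_exists_fun ℂ).1 (hΨ k)
    rw [traceB_proj]
    convert hsep.slicesState_mul_mul (1 : Matrix (Fin m) (Fin m) ℂ) (Matrix.of w)ᵀ using 2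
    ext j a k
    simpa [Finset.sum_apply, sliceCol, Matrix.mul_apply, mul_comm]
      using (congrFun (hw k) (a, j)).symm

theorem isEB_ofSlices_vecMulVec (μ : Fin n → Fin m → ℂ) (ν : Fin n → Fin r → ℂ) :
    IsEB (ofSlices fun j => Matrix.vecMulVec (μ j) (ν j)) :=
  isEB_ofSlices.2 (isSeparable_slicesState_vecMulVec μ ν)

theorem IsEB.image {V : Submodule ℂ (Bip m n)} (hV : IsEB V) (W : Matrix (Fin m') (Fin m) ℂ)
    {U : Matrix (Fin n) (Fin n) ℂ} (hU : U ∈ Matrix.unitaryGroup (Fin n) ℂ) :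
    IsEB (image W U V) := by
  obtain ⟨r, hr⟩ : ∃ r, Module.finrank ℂ V = r := ⟨_, rfl⟩
  obtain ⟨M, rfl, -⟩ := exists_eq_ofSlices V hr
  have hsep := isEB_ofSlices.1 hV
  rw [← slicesState_mix hU] at hsep
  rw [image_ofSlices, isEB_ofSlices]
  simpa only [Matrix.mul_one] using hsep.slicesState_mul_mul W (1 : Matrix (Fin r) (Fin r) ℂ)

theorem isEB_map_embedB {k : ℕ} (hk : k ≤ n) (T : Submodule ℂ (Bip m k)) :
    IsEB (T.map (embedB hk)) ↔ IsEB T := by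
  obtain ⟨r, hr⟩ : ∃ r, Module.finrank ℂ T = r := ⟨_, rfl⟩
  obtain ⟨M, rfl, -⟩ := exists_eq_ofSlices T hr
  rw [map_embedB_ofSlices, isEB_ofSlices, isEB_ofSlices, slicesState_pad hk]

end IsEB

section Unitary

variable {n : ℕ} {ι E : Type*} [Fintype ι] [AddCommGroup E] [Module ℂ E]

theorem isUnit_det_of_mem_unitaryGroup [DecidableEq ι] {U : Matrix ι ι ℂ}
    (hU : U ∈ Matrix.unitaryGroup ι ℂ) : IsUnit U.det :=
  (Matrix.isUnit_iff_isUnit_det U).1 (Unitary.isUnit_coe (U := ⟨U, hU⟩))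

theorem of_mem_unitaryGroup_of_orthonormal [DecidableEq ι] {v : ι → EuclideanSpace ℂ ι}
    (hv : Orthonormal ℂ v) :
    (Matrix.of fun i j => v i j) ∈ Matrix.unitaryGroup ι ℂ := by
  rw [← Matrix.map_star_mem_unitaryGroup_iff, Matrix.mem_unitaryGroup_iff]
  ext i j
  simpa [Matrix.mul_apply, Matrix.one_apply, EuclideanSpace.inner_eq_star_dotProduct, dotProduct,
    mul_comm] using orthonormal_iff_ite.1 hv i j

theorem exists_orthonormalBasis_mem {F : Type*} [NormedAddCommGroup F] [InnerProductSpace ℂ F]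
    [FiniteDimensional ℂ F] (hι : Module.finrank ℂ F = Fintype.card ι) (K : Submodule ℂ F)
    (p : ι → Prop) [DecidablePred p] (hp : Module.finrank ℂ K = Fintype.card {i // p i}) :
    ∃ b : OrthonormalBasis ι ℂ F, ∀ i, p i → b i ∈ K := by
  let q : OrthonormalBasis {i // p i} ℂ K := (stdOrthonormalBasis ℂ K).reindex
    (Fintype.equivOfCardEq (by rw [Fintype.card_fin, hp]))
  let v : ι → F := fun i => if h : p i then q ⟨i, h⟩ else 0
  have hv : Orthonormal ℂ (Set.domRestrict {i | p i} v) := by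
    have hrestrict : Set.domRestrict {i | p i} v = fun i : {i // p i} => (q i : F) :=
      funext fun i => dif_pos i.2
    rw [hrestrict]
    exact q.orthonormal.comp_linearIsometry K.subtypeₗᵢ
  obtain ⟨b, hb⟩ := hv.exists_orthonormalBasis_extension_of_card_eq hι
  refine ⟨b, fun i hi => ?_⟩
  rw [hb i hi]
  simp [v, hi]

theorem exists_unitary_mix_eq_zero (M : Fin n → E) :
    ∃ U ∈ Matrix.unitaryGroup (Fin n) ℂ, ∀ j : Fin n,
      Module.finrank ℂ (Submodule.span ℂ (Set.range M)) ≤ j → mix U M j = 0 := by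
  let f : EuclideanSpace ℂ (Fin n) →ₗ[ℂ] E :=
    Fintype.linearCombination ℂ M ∘ₗ (WithLp.linearEquiv 2 ℂ (Fin n → ℂ)).toLinearMap
  set r := Module.finrank ℂ (Submodule.span ℂ (Set.range M))
  have hrange : Module.finrank ℂ f.range = r := by
    rw [LinearEquiv.range_comp, Fintype.range_linearCombination]
  have hker : Module.finrank ℂ f.ker = Fintype.card {j : Fin n // r ≤ j} := by
    have hrn : r ≤ n := (finrank_range_le_card (R := ℂ) M).trans_eq (Fintype.card_fin n)
    have hadd := f.finrank_range_add_finrank_ker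
    have hcompl := Fintype.card_subtype_compl fun j : Fin n => (j : ℕ) < r
    simp only [not_lt, Fintype.card_fin_lt_of_le hrn, Fintype.card_fin] at hcompl
    rw [finrank_euclideanSpace_fin] at hadd
    omega
  obtain ⟨b, hb⟩ := exists_orthonormalBasis_mem (by simp) f.ker (fun j : Fin n => r ≤ j) hker
  exact ⟨_, of_mem_unitaryGroup_of_orthonormal b.orthonormal, fun j hj => hb j hj⟩

end Unitary

section RankB

variable {m m' n n' r : ℕ}

theorem image_inv_image {W : Matrix (Fin m) (Fin m) ℂ} {U : Matrix (Fin n) (Fin n) ℂ}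
    (hW : IsUnit W.det) (hU : IsUnit U.det) (V : Submodule ℂ (Bip m n)) :
    image W⁻¹ U⁻¹ (image W U V) = V := by
  rw [image_image, Matrix.nonsing_inv_mul _ hW, Matrix.nonsing_inv_mul _ hU, image_one]

theorem finrank_image {W : Matrix (Fin m) (Fin m) ℂ} {U : Matrix (Fin n) (Fin n) ℂ}
    (hW : IsUnit W.det) (hU : IsUnit U.det) (V : Submodule ℂ (Bip m n)) :
    Module.finrank ℂ (image W U V) = Module.finrank ℂ V := by
  refine le_antisymm (Submodule.finrank_map_le _ _) ?_
  conv_lhs => rw [← image_inv_image hW hU V]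
  exact Submodule.finrank_map_le _ _

theorem supportB_image_le (W : Matrix (Fin m') (Fin m) ℂ) (U : Matrix (Fin n') (Fin n) ℂ)
    (V : Submodule ℂ (Bip m n)) : supportB (image W U V) ≤ (supportB V).map U.mulVecLin := by
  rw [supportB, Submodule.span_le]
  rintro _ ⟨_, ⟨v, hv, rfl⟩, i, rfl⟩
  refine ⟨∑ a, W i a • fun j => v (a, j), Submodule.sum_mem _ fun a _ =>
    Submodule.smul_mem _ _ (Submodule.subset_span ⟨v, hv, a, rfl⟩), ?_⟩
  ext j
  simp only [Matrix.mulVecLin_apply, Matrix.mulVec, dotProduct, Finset.sum_apply, Pi.smul_apply,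
    smul_eq_mul, Fintype.sum_prod_type, Matrix.kroneckerMap_apply, Finset.mul_sum]
  rw [Finset.sum_comm]
  exact Finset.sum_congr rfl fun a _ => Finset.sum_congr rfl fun k _ => by ring

theorem rankB_image_le (W : Matrix (Fin m') (Fin m) ℂ) (U : Matrix (Fin n') (Fin n) ℂ)
    (V : Submodule ℂ (Bip m n)) : rankB (image W U V) ≤ rankB V :=
  (Submodule.finrank_mono (supportB_image_le W U V)).trans (Submodule.finrank_map_le _ _)

theorem rankB_image {W : Matrix (Fin m) (Fin m) ℂ} {U : Matrix (Fin n) (Fin n) ℂ}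
    (hW : IsUnit W.det) (hU : IsUnit U.det) (V : Submodule ℂ (Bip m n)) :
    rankB (image W U V) = rankB V := by
  refine le_antisymm (rankB_image_le _ _ _) ?_
  conv_lhs => rw [← image_inv_image hW hU V]
  exact rankB_image_le _ _ _

theorem supportB_ofSlices (M : Fin n → Matrix (Fin m) (Fin r) ℂ) :
    supportB (ofSlices M) = Submodule.span ℂ (Set.range (sliceMatrix M).col) := by
  refine le_antisymm ?_ ?_ <;> rw [supportB, Submodule.span_le]
  · rintro _ ⟨v, hv, i, rfl⟩
    obtain ⟨w, rfl⟩ := (Submodule.mem_span_range_iff_exists_fun ℂ).1 hv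
    have hcol : (fun j => (∑ c, w c • sliceCol M c) (i, j))
        = ∑ c, w c • (sliceMatrix M).col (i, c) := by
      ext j
      simp [Finset.sum_apply, sliceMatrix, sliceCol]
    rw [SetLike.mem_coe, hcol]
    exact Submodule.sum_mem _ fun c _ => Submodule.smul_mem _ _ (Submodule.subset_span ⟨_, rfl⟩)
  · rintro _ ⟨⟨a, c⟩, rfl⟩
    exact Submodule.subset_span ⟨_, Submodule.subset_span ⟨c, rfl⟩, a, rfl⟩

theorem rankB_ofSlices (M : Fin n → Matrix (Fin m) (Fin r) ℂ) :
    rankB (ofSlices M) = Module.finrank ℂ (Submodule.span ℂ (Set.range M)) := by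
  let vec : Matrix (Fin m) (Fin r) ℂ ≃ₗ[ℂ] Fin m × Fin r → ℂ :=
    (LinearEquiv.curry ℂ ℂ (Fin m) (Fin r)).symm
  have hrow : (sliceMatrix M).row = vec ∘ M := rfl
  rw [rankB, supportB_ofSlices, ← Matrix.rank_eq_finrank_span_cols,
    Matrix.rank_eq_finrank_span_row, hrow, Set.range_comp, ← LinearEquiv.coe_coe,
    ← Submodule.map_span, LinearEquiv.finrank_map_eq]

theorem rankB_ofSlices_eq_iff {M : Fin n → Matrix (Fin m) (Fin r) ℂ} :
    rankB (ofSlices M) = n ↔ LinearIndependent ℂ M := by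
  rw [linearIndependent_iff_card_eq_finrank_span, Fintype.card_fin, rankB_ofSlices]
  exact eq_comm

theorem rankB_le (V : Submodule ℂ (Bip m n)) : rankB V ≤ n :=
  (Submodule.finrank_le (supportB V)).trans_eq (Module.finrank_fin_fun ℂ)

theorem rankB_le_mul_finrank (V : Submodule ℂ (Bip m n)) :
    rankB V ≤ m * Module.finrank ℂ V := by
  obtain ⟨r, hr⟩ : ∃ r, Module.finrank ℂ V = r := ⟨_, rfl⟩
  obtain ⟨M, rfl, -⟩ := exists_eq_ofSlices V hr
  rw [rankB_ofSlices, hr]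
  simpa [Module.finrank_matrix] using
    Submodule.finrank_le (Submodule.span ℂ (Set.range M))

theorem span_range_pad {E : Type*} [AddCommGroup E] [Module ℂ E] {k : ℕ} (hk : k ≤ n)
    (M : Fin k → E) :
    Submodule.span ℂ (Set.range (pad n M)) = Submodule.span ℂ (Set.range M) := by
  refine le_antisymm ?_ ?_ <;> rw [Submodule.span_le] <;> rintro _ ⟨j, rfl⟩
  · by_cases h : (j : ℕ) < k
    · exact Submodule.subset_span ⟨⟨j, h⟩, by simp [pad, h]⟩
    · simp [pad, h]
  · exact Submodule.subset_span ⟨Fin.castLE hk j, by simp [pad]⟩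

theorem exists_map_embedB_eq_image (V : Submodule ℂ (Bip m n)) :
    ∃ (T : Submodule ℂ (Bip m (rankB V))), ∃ U ∈ Matrix.unitaryGroup (Fin n) ℂ,
      T.map (embedB (rankB_le V)) = image 1 U V ∧ rankB T = rankB V := by
  obtain ⟨r, hr⟩ : ∃ r, Module.finrank ℂ V = r := ⟨_, rfl⟩
  obtain ⟨M, rfl, -⟩ := exists_eq_ofSlices V hr
  obtain ⟨U, hU, hzero⟩ := exists_unitary_mix_eq_zero M
  set k := rankB (ofSlices M)
  let N : Fin k → Matrix (Fin m) (Fin r) ℂ := fun j => mix U M (Fin.castLE (rankB_le _) j)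
  have hpad : pad n N = mix U M := by
    funext j
    by_cases h : (j : ℕ) < k
    · simp [pad, N, h]
    · rw [hzero j (by rw [← rankB_ofSlices]; exact not_lt.1 h)]
      simp [pad, h]
  refine ⟨ofSlices N, U, hU, ?_, ?_⟩
  · simp only [map_embedB_ofSlices, hpad, image_ofSlices, Matrix.one_mul]
  · rw [rankB_ofSlices, ← span_range_pad (rankB_le (ofSlices M)), hpad,
      span_range_mix (isUnit_det_of_mem_unitaryGroup hU), ← rankB_ofSlices]

end RankB

section SlicesStateSpan

variable {α β ι κ : Type*}

theorem sliceMatrix_mulVec_single [Fintype α] [Fintype β] [DecidableEq α] [DecidableEq β]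
    (M : ι → Matrix α β ℂ)
    (φ : Matrix α β ℂ →ₗ[ℂ] ℂ) :
    sliceMatrix M *ᵥ (fun x => φ (Matrix.single x.1 x.2 1)) = fun j => φ (M j) := by
  ext j
  conv_rhs => rw [Matrix.matrix_eq_sum_single (M j)]
  simp only [map_sum, Matrix.mulVec, dotProduct, Fintype.sum_prod_type]
  refine Finset.sum_congr rfl fun a _ => Finset.sum_congr rfl fun c _ => ?_
  rw [sliceMatrix, Matrix.of_apply, ← smul_eq_mul, ← map_smul, Matrix.smul_single, smul_eq_mul,
    mul_one]

theorem ofReal_sum_norm_sq_map [Fintype α] [Fintype β] [DecidableEq α] [DecidableEq β] [Fintype ι]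
    (M : ι → Matrix α β ℂ) (φ : Matrix α β ℂ →ₗ[ℂ] ℂ) :
    ((∑ j, ‖φ (M j)‖ ^ 2 : ℝ) : ℂ) = (fun x => φ (Matrix.single x.1 x.2 1)) ᵥ* slicesState M ⬝ᵥ
      star fun x => φ (Matrix.single x.1 x.2 1) := by
  rw [slicesState, ← Matrix.vecMul_vecMul, ← Matrix.dotProduct_mulVec,
    Matrix.mulVec_conjTranspose, star_star, Matrix.vecMul_transpose, sliceMatrix_mulVec_single]
  simp [dotProduct, Complex.mul_conj']

variable [Finite α] [Finite β] [Fintype ι] [Fintype κ]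

theorem sum_norm_sq_eq_of_slicesState_eq {M : ι → Matrix α β ℂ} {P : κ → Matrix α β ℂ}
    (h : slicesState M = slicesState P) (φ : Matrix α β ℂ →ₗ[ℂ] ℂ) :
    ∑ j, ‖φ (M j)‖ ^ 2 = ∑ s, ‖φ (P s)‖ ^ 2 := by
  classical
  cases nonempty_fintype α
  cases nonempty_fintype β
  apply Complex.ofReal_injective
  rw [ofReal_sum_norm_sq_map, ofReal_sum_norm_sq_map, h]

theorem span_range_le_of_slicesState_eq {M : ι → Matrix α β ℂ} {P : κ → Matrix α β ℂ}
    (h : slicesState M = slicesState P) :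
    Submodule.span ℂ (Set.range P) ≤ Submodule.span ℂ (Set.range M) := by
  rw [Submodule.span_le]
  rintro _ ⟨s, rfl⟩
  by_contra hs
  obtain ⟨φ, hφ, hker⟩ := Submodule.exists_le_ker_of_notMem hs
  have hM : ∑ j, ‖φ (M j)‖ ^ 2 = 0 := Finset.sum_eq_zero fun j _ => by
    rw [hker (Submodule.subset_span ⟨j, rfl⟩), norm_zero, zero_pow two_ne_zero]
  rw [sum_norm_sq_eq_of_slicesState_eq h, Finset.sum_eq_zero_iff_of_nonneg fun s _ => by positivity]
    at hM
  exact hφ (by simpa using hM s (Finset.mem_univ s))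

theorem span_range_eq_of_slicesState_eq {M : ι → Matrix α β ℂ} {P : κ → Matrix α β ℂ}
    (h : slicesState M = slicesState P) :
    Submodule.span ℂ (Set.range M) = Submodule.span ℂ (Set.range P) :=
  (span_range_le_of_slicesState_eq h.symm).antisymm (span_range_le_of_slicesState_eq h)

end SlicesStateSpan

section RankBound

variable {m n : ℕ}

theorem sum_smul_sliceCol_eq_zero_iff {r : ℕ} {M : Fin n → Matrix (Fin m) (Fin r) ℂ}
    {g : Fin r → ℂ} : ∑ c, g c • sliceCol M c = 0 ↔ ∀ j, M j *ᵥ g = 0 := by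
  simp only [funext_iff, Prod.forall, Finset.sum_apply, Pi.smul_apply, sliceCol, smul_eq_mul,
    Matrix.mulVec, dotProduct, Pi.zero_apply, mul_comm (g _)]
  exact forall_comm

theorem exists_forall_dotProduct_ne_zero {ι κ : Type*} [Fintype ι] [Finite κ] (μ : κ → ι → ℂ) :
    ∃ w : ι → ℂ, ∀ s, μ s ≠ 0 → w ⬝ᵥ μ s ≠ 0 := by
  classical
  obtain ⟨f, hf⟩ := Module.exists_dual_forall_apply_ne_zero (K := ℂ)
    (fun s : {s // μ s ≠ 0} => μ s) fun s => s.2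
  obtain ⟨w, rfl⟩ := (dotProductEquiv ℂ ι).surjective f
  exact ⟨w, fun s hs => hf ⟨s, hs⟩⟩

theorem IsEB.finrank_le_rankB {V : Submodule ℂ (Bip m n)} (hV : IsEB V) :
    Module.finrank ℂ V ≤ rankB V := by
  obtain ⟨r, hr⟩ : ∃ r, Module.finrank ℂ V = r := ⟨_, rfl⟩
  obtain ⟨M, rfl, hli⟩ := exists_eq_ofSlices V hr
  obtain ⟨N, μ, ν, hN⟩ := isSeparable_iff.1 (isEB_ofSlices.1 hV)
  have hspan := span_range_eq_of_slicesState_eq hN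
  obtain ⟨w, hw⟩ := exists_forall_dotProduct_ne_zero μ
  let A : Matrix (Fin n) (Fin r) ℂ := Matrix.of fun j => w ᵥ* M j
  have hP : ∀ g, A *ᵥ g = 0 → ∀ s, Matrix.vecMulVec (μ s) (ν s) *ᵥ g = 0 := by
    intro g hg s
    have hfunctional : w ⬝ᵥ (Matrix.vecMulVec (μ s) (ν s) *ᵥ g) = 0 := by
      have hmem := hspan.ge (Submodule.subset_span ⟨s, rfl⟩)
      refine LinearMap.eqOn_span (f := (dotProductEquiv ℂ _ w) ∘ₗ
        (Matrix.mulVecBilin ℂ ℂ).flip g) (g := 0) ?_ hmem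
      rintro _ ⟨j, rfl⟩
      exact (Matrix.dotProduct_mulVec w (M j) g).trans (congrFun hg j)
    rw [Matrix.vecMulVec_mulVec] at hfunctional ⊢
    by_cases hμ : μ s = 0
    · simp [hμ]
    · have : ν s ⬝ᵥ g = 0 := by simpa [hw s hμ] using hfunctional
      simp [this]
  have hA : Function.Injective A.mulVecLin := by
    refine (injective_iff_map_eq_zero _).2 fun g hg => ?_
    have hM : ∀ j, M j *ᵥ g = 0 := fun j => by
      refine LinearMap.eqOn_span (f := (Matrix.mulVecBilin ℂ ℂ).flip g) (g := 0) ?_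
        (hspan.le (Submodule.subset_span ⟨j, rfl⟩))
      rintro _ ⟨s, rfl⟩
      exact hP g hg s
    exact funext (Fintype.linearIndependent_iff.1 hli g (sum_smul_sliceCol_eq_zero_iff.2 hM))
  calc Module.finrank ℂ (ofSlices M) = A.rank := by
        rw [Matrix.rank, LinearMap.finrank_range_of_inj hA, hr, Module.finrank_fin_fun]
    _ = Module.finrank ℂ ((Submodule.span ℂ (Set.range M)).map (Matrix.vecMulBilin ℂ ℂ w)) := by
        rw [Matrix.rank_eq_finrank_span_row, Submodule.map_span, ← Set.range_comp]
        rfl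
    _ ≤ rankB (ofSlices M) := by
        rw [rankB_ofSlices]
        exact Submodule.finrank_map_le _ _

theorem exists_luEquivalent {V : Submodule ℂ (Bip m n)} (hV : IsEB V) :
    ∃ T : Submodule ℂ (Bip m (rankB V)), IsEB T ∧ rankB T = rankB V ∧
      LUEquivalent V (T.map (embedB (rankB_le V))) := by
  obtain ⟨T, U, hU, himage, hrank⟩ := exists_map_embedB_eq_image V
  refine ⟨T, ?_, hrank, ?_, 1, U, one_mem _, hU, fun a ha => ?_⟩
  · rw [← isEB_map_embedB (rankB_le V), himage]
    exact hV.image 1 hU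
  · rw [himage, finrank_image (by simp) (isUnit_det_of_mem_unitaryGroup hU)]
  · rw [himage]
    exact Submodule.mem_map_of_mem ha

end RankBound

section Takagi

open scoped ComplexConjugate InnerProductSpace

theorem exists_antilinear_eigenvector_of_sq {E : Type*} [AddCommGroup E] [Module ℂ E]
    (T : E →ₗ⋆[ℂ] E) {x : E} (hx : x ≠ 0) {lam : ℝ} (h : T (T x) = ((lam : ℂ) * lam) • x) :
    ∃ y : E, y ≠ 0 ∧ T y = (lam : ℂ) • y := by
  by_cases hy : T x + (lam : ℂ) • x = 0
  · refine ⟨Complex.I • x, smul_ne_zero Complex.I_ne_zero hx, ?_⟩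
    rw [map_smulₛₗ, eq_neg_of_add_eq_zero_left hy, Complex.conj_I, smul_neg, neg_smul, neg_neg,
      smul_comm]
  · refine ⟨_, hy, ?_⟩
    rw [map_add, map_smulₛₗ, h, Complex.conj_ofReal, smul_add, smul_smul, add_comm]

variable {E : Type*} [NormedAddCommGroup E] [InnerProductSpace ℂ E] [FiniteDimensional ℂ E]

theorem exists_norm_one_antilinear_eigenvector [Nontrivial E] (T : E →ₗ⋆[ℂ] E)
    (hT : ∀ x y, ⟪x, T y⟫_ℂ = ⟪y, T x⟫_ℂ) :
    ∃ x : E, ‖x‖ = 1 ∧ ∃ lam : ℝ, 0 ≤ lam ∧ T x = (lam : ℂ) • x := by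
  obtain ⟨κ, hκ⟩ := Module.End.exists_eigenvalue (T.comp T : Module.End ℂ E)
  obtain ⟨x, hx⟩ := hκ.exists_hasEigenvector
  have hTTx : T (T x) = κ • x := hx.apply_eq_smul
  have hx0 : (‖x‖ : ℂ) ≠ 0 := by simpa using hx.2
  have hκ_norm : κ * ‖x‖ ^ 2 = ‖T x‖ ^ 2 := by
    have hinner := hT x (T x)
    rwa [hTTx, inner_smul_right, inner_self_eq_norm_sq_to_K, inner_self_eq_norm_sq_to_K] at hinner
  let lam : ℝ := ‖T x‖ / ‖x‖
  have hκ_sq : κ = (lam : ℂ) * lam := by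
    simp only [lam, Complex.ofReal_div]
    field_simp
    exact hκ_norm
  obtain ⟨y, hy, hTy⟩ := exists_antilinear_eigenvector_of_sq T hx.2 (hκ_sq ▸ hTTx)
  refine ⟨((‖y‖⁻¹ : ℝ) : ℂ) • y, ?_, lam, by positivity, ?_⟩
  · rw [norm_smul, Complex.norm_real, norm_inv, norm_norm, inv_mul_cancel₀ (norm_ne_zero_iff.2 hy)]
  · rw [map_smulₛₗ, hTy, Complex.conj_ofReal, smul_comm]

theorem exists_orthonormal_antilinear_eigenvectors {n : ℕ} (T : E →ₗ⋆[ℂ] E)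
    (hT : ∀ x y, ⟪x, T y⟫_ℂ = ⟪y, T x⟫_ℂ) (hn : Module.finrank ℂ E = n) :
    ∃ v : Fin n → E, Orthonormal ℂ v ∧ ∃ lam : Fin n → ℝ,
      ∀ i, 0 ≤ lam i ∧ T (v i) = (lam i : ℂ) • v i := by
  induction n generalizing E with
  | zero => exact ⟨Fin.elim0, ⟨fun i => i.elim0, fun i => i.elim0⟩, Fin.elim0, fun i => i.elim0⟩
  | succ n ih =>
    have : Nontrivial E := Module.nontrivial_of_finrank_pos (R := ℂ) (by omega)
    have : Fact (Module.finrank ℂ E = n + 1) := ⟨hn⟩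
    obtain ⟨x, hx, l, hl, hTx⟩ := exists_norm_one_antilinear_eigenvector T hT
    have hT_orthogonal : ∀ y ∈ (ℂ ∙ x)ᗮ, T y ∈ (ℂ ∙ x)ᗮ := by
      intro y hy
      rw [Submodule.mem_orthogonal_singleton_iff_inner_right] at hy ⊢
      rw [hT, hTx, inner_smul_right, ← inner_conj_symm, hy, map_zero, mul_zero]
    obtain ⟨v, hv, lam, hlam⟩ := ih
      ((T.comp (ℂ ∙ x)ᗮ.subtype).codRestrict _ fun y => hT_orthogonal y y.2) (fun y z => hT y z)
      (Submodule.finrank_orthogonal_span_singleton (norm_ne_zero_iff.1 (hx ▸ one_ne_zero)))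
    refine ⟨Matrix.vecCons x fun i => v i, orthonormal_vecCons_iff.2 ⟨hx, fun i => ?_, ?_⟩,
      Matrix.vecCons l lam, Fin.cases ⟨hl, hTx⟩ fun i => ⟨(hlam i).1, ?_⟩⟩
    · exact Submodule.mem_orthogonal_singleton_iff_inner_right.1 (v i).2
    · exact hv.comp_linearIsometry (ℂ ∙ x)ᗮ.subtypeₗᵢ
    · exact congrArg Subtype.val (hlam i).2

/-- Autonne–Takagi factorization. -/
theorem exists_unitary_mul_mul_transpose_eq_diagonal {n : ℕ} {A : Matrix (Fin n) (Fin n) ℂ}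
    (hA : A.IsSymm) : ∃ U ∈ Matrix.unitaryGroup (Fin n) ℂ, ∃ lam : Fin n → ℝ,
      (∀ i, 0 ≤ lam i) ∧ U * A * Uᵀ = Matrix.diagonal fun i => (lam i : ℂ) := by
  let T : EuclideanSpace ℂ (Fin n) →ₗ⋆[ℂ] EuclideanSpace ℂ (Fin n) :=
    { toFun := fun x => WithLp.toLp 2 (star (A *ᵥ x.ofLp))
      map_add' := fun x y => by simp [Matrix.mulVec_add]
      map_smul' := fun c x => by
        ext i
        simp [Matrix.mulVec_smul] }
  have hinner : ∀ x y, inner ℂ x (T y) = star (x.ofLp ⬝ᵥ A *ᵥ y.ofLp) := by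
    intro x y
    simp [T, EuclideanSpace.inner_eq_star_dotProduct, dotProduct, mul_comm]
  have hT : ∀ x y, inner ℂ x (T y) = inner ℂ y (T x) := by
    intro x y
    rw [hinner, hinner, Matrix.dotProduct_mulVec, ← Matrix.mulVec_transpose, hA.eq,
      dotProduct_comm]
  obtain ⟨v, hv, lam, hlam⟩ := exists_orthonormal_antilinear_eigenvectors T hT
    finrank_euclideanSpace_fin
  refine ⟨_, of_mem_unitaryGroup_of_orthonormal hv, lam, fun i => (hlam i).1, ?_⟩
  ext i j
  calc ((Matrix.of fun i j => v i j) * A * (Matrix.of fun i j => v i j)ᵀ) i j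
      = star (inner ℂ (v i) (T (v j))) := by
        rw [hinner, star_star, Matrix.mul_assoc]
        simp [Matrix.mul_apply, dotProduct, Matrix.mulVec]
    _ = Matrix.diagonal (fun i => (lam i : ℂ)) i j := by
        rw [(hlam j).2, inner_smul_right, orthonormal_iff_ite.1 hv]
        by_cases h : i = j
        · subst h
          simp
        · simp [h]

end Takagi

section Polygon

theorem two_mul_norm_le_sum_norm {ι : Type*} [Fintype ι] {z : ι → ℂ} (hz : ∑ j, z j = 0) (i : ι) :
    2 * ‖z i‖ ≤ ∑ j, ‖z j‖ := by
  classical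
  have hi : z i = -∑ j ∈ Finset.univ.erase i, z j := by
    rw [eq_neg_iff_add_eq_zero, Finset.add_sum_erase _ _ (Finset.mem_univ i), hz]
  have hle : ‖z i‖ ≤ ∑ j ∈ Finset.univ.erase i, ‖z j‖ := by
    rw [hi, norm_neg]
    exact norm_sum_le _ _
  rw [← Finset.add_sum_erase _ (fun j => ‖z j‖) (Finset.mem_univ i)]
  linarith

theorem exists_norm_add_mul_eq {a b r : ℝ} (hdiff : |a - b| ≤ r) (hsum : r ≤ a + b) :
    ∃ u : ℂ, ‖u‖ = 1 ∧ ‖(a : ℂ) + b * u‖ = r := by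
  have hcont : ContinuousOn (fun t : ℝ => ‖(a : ℂ) + b * Complex.exp (t * Complex.I)‖)
      (Set.Icc 0 Real.pi) := by fun_prop
  have hmem : r ∈ Set.Icc ‖(a : ℂ) + b * Complex.exp ((Real.pi : ℝ) * Complex.I)‖
      ‖(a : ℂ) + b * Complex.exp ((0 : ℝ) * Complex.I)‖ := by
    constructor
    · rwa [Complex.exp_pi_mul_I, mul_neg_one, ← sub_eq_add_neg, ← Complex.ofReal_sub,
        Complex.norm_real]
    · rw [Complex.ofReal_zero, zero_mul, Complex.exp_zero, mul_one, ← Complex.ofReal_add,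
        Complex.norm_real]
      exact hsum.trans (le_abs_self _)
  obtain ⟨t, -, ht⟩ := intermediate_value_Icc' Real.pi_pos.le hcont hmem
  exact ⟨_, Complex.norm_exp_ofReal_mul_I t, ht⟩

theorem exists_norm_one_triangle {a b r : ℝ} (hdiff : |a - b| ≤ r) (hsum : r ≤ a + b) :
    ∃ u v : ℂ, ‖u‖ = 1 ∧ ‖v‖ = 1 ∧ a * u + b * v = r := by
  obtain ⟨w, hw, hr⟩ := exists_norm_add_mul_eq hdiff hsum
  obtain ⟨c, hc, hrot⟩ := Complex.exists_norm_eq_mul_self ((a : ℂ) + b * w)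
  refine ⟨c, c * w, hc, by rw [norm_mul, hc, hw, one_mul], ?_⟩
  rw [← hr, hrot]
  ring

theorem exists_norm_one_sum_mul_eq_zero {l : Fin 4 → ℝ} (h0 : ∀ i, 0 ≤ l i)
    (h : ∀ i, 2 * l i ≤ ∑ j, l j) : ∃ u : Fin 4 → ℂ, (∀ i, ‖u i‖ = 1) ∧ ∑ i, l i * u i = 0 := by
  simp only [Fin.sum_univ_four, Fin.forall_fin_succ, Fin.isValue, Fin.succ_zero_eq_one,
    Fin.succ_one_eq_two, IsEmpty.forall_iff, and_true] at h h0 ⊢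
  -- `r` is the length of a diagonal of the quadrilateral
  let r := max |l 0 - l 1| |l 2 - l 3|
  have h01 : r ≤ l 0 + l 1 := by
    refine max_le (abs_le.2 ⟨?_, ?_⟩) (abs_le.2 ⟨?_, ?_⟩) <;> grind
  have h23 : r ≤ l 2 + l 3 := by
    refine max_le (abs_le.2 ⟨?_, ?_⟩) (abs_le.2 ⟨?_, ?_⟩) <;> grind
  obtain ⟨u, v, hu, hv, huv⟩ := exists_norm_one_triangle (le_max_left _ _) h01
  obtain ⟨w, x, hw, hx, hwx⟩ := exists_norm_one_triangle (le_max_right _ _) h23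
  refine ⟨![u, v, -w, -x], by simp [hu, hv, hw, hx], ?_⟩
  simp only [Matrix.cons_val]
  linear_combination huv - hwx

theorem exists_sq_eq_of_norm_eq_one {u : ℂ} (hu : ‖u‖ = 1) : ∃ e : ℂ, ‖e‖ = 1 ∧ e ^ 2 = u := by
  obtain ⟨e, rfl⟩ := IsAlgClosed.exists_pow_nat_eq u two_pos
  rw [norm_pow] at hu
  exact ⟨e, (pow_eq_one_iff_of_nonneg (norm_nonneg _) two_ne_zero).1 hu, rfl⟩

end Polygon

section PolarDet

variable {ι κ : Type*}

/-- The symmetric bilinear form that polarizes `X ↦ 2 * det X` on two-by-two matrices. -/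
def polarDet : Matrix (Fin 2) (Fin 2) ℂ →ₗ[ℂ] Matrix (Fin 2) (Fin 2) ℂ →ₗ[ℂ] ℂ :=
  LinearMap.mk₂ ℂ (fun X Y => X 0 0 * Y 1 1 + X 1 1 * Y 0 0 - X 0 1 * Y 1 0 - X 1 0 * Y 0 1)
    (fun X X' Y => by simp only [Matrix.add_apply]; ring)
    (fun c X Y => by simp only [Matrix.smul_apply, smul_eq_mul]; ring)
    (fun X Y Y' => by simp only [Matrix.add_apply]; ring)
    (fun c X Y => by simp only [Matrix.smul_apply, smul_eq_mul]; ring)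

theorem polarDet_apply (X Y : Matrix (Fin 2) (Fin 2) ℂ) :
    polarDet X Y = X 0 0 * Y 1 1 + X 1 1 * Y 0 0 - X 0 1 * Y 1 0 - X 1 0 * Y 0 1 := rfl

theorem polarDet_self (X : Matrix (Fin 2) (Fin 2) ℂ) : polarDet X X = 2 * X.det := by
  rw [polarDet_apply, Matrix.det_fin_two]
  ring

theorem polarDet_comm (X Y : Matrix (Fin 2) (Fin 2) ℂ) : polarDet X Y = polarDet Y X := by
  simp only [polarDet_apply]
  ring

theorem polarDet_vecMulVec (μ ν μ' ν' : Fin 2 → ℂ) :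
    polarDet (Matrix.vecMulVec μ ν) (Matrix.vecMulVec μ' ν')
      = (!![μ 0, μ' 0; μ 1, μ' 1]).det * (!![ν 0, ν 1; ν' 0, ν' 1]).det := by
  simp only [polarDet_apply, Matrix.vecMulVec_apply, Matrix.det_fin_two_of]
  ring

open scoped ComplexOrder in
theorem exists_eq_vecMulVec {X : Matrix (Fin 2) (Fin 2) ℂ} (hX : X.det = 0) :
    ∃ μ ν : Fin 2 → ℂ, X = Matrix.vecMulVec μ ν := by
  obtain ⟨v, hv, hXv⟩ := Matrix.exists_mulVec_eq_zero_iff.2 hX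
  have hnorm : star v ⬝ᵥ v ≠ 0 := by rwa [Ne, dotProduct_star_self_eq_zero]
  simp only [dotProduct, Pi.star_apply, Fin.sum_univ_two] at hnorm
  -- the rows of `X` are multiples of a vector orthogonal to the kernel
  let ν : Fin 2 → ℂ := ![v 1, -v 0]
  refine ⟨(star (v 0) * v 0 + star (v 1) * v 1)⁻¹ • X *ᵥ star ν, ν, ?_⟩
  ext i k
  have hrow : X i 0 * v 0 + X i 1 * v 1 = 0 := by
    simpa [Matrix.mulVec, dotProduct] using congrFun hXv i
  have hcoeff : (X *ᵥ star ν) i = X i 0 * star (v 1) - X i 1 * star (v 0) := by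
    simp [ν, Matrix.mulVec, dotProduct, sub_eq_add_neg]
  rw [Matrix.vecMulVec_apply, Pi.smul_apply, smul_eq_mul, hcoeff, inv_mul_eq_div,
    div_mul_eq_mul_div, eq_div_iff hnorm]
  fin_cases k
  · simp only [ν, Fin.zero_eta, Matrix.cons_val_zero]
    linear_combination star (v 0) * hrow
  · simp only [ν, Fin.mk_one, Matrix.cons_val_one, Matrix.cons_val_fin_one]
    linear_combination star (v 1) * hrow

/-- The Gram matrix of a family with respect to `polarDet`. -/
def gram (M : ι → Matrix (Fin 2) (Fin 2) ℂ) : Matrix ι ι ℂ :=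
  Matrix.of fun i j => polarDet (M i) (M j)

theorem gram_isSymm (M : ι → Matrix (Fin 2) (Fin 2) ℂ) : (gram M).IsSymm := by
  ext i j
  exact polarDet_comm _ _

theorem gram_mix [Fintype ι] (U : Matrix κ ι ℂ) (M : ι → Matrix (Fin 2) (Fin 2) ℂ) :
    gram (mix U M) = U * gram M * Uᵀ := by
  ext i j
  simp only [gram, Matrix.of_apply, mix, map_sum, LinearMap.sum_apply, map_smul,
    LinearMap.smul_apply, smul_eq_mul, Matrix.mul_apply, Matrix.transpose_apply, Finset.mul_sum,
    Finset.sum_mul]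
  exact Finset.sum_congr rfl fun k _ => Finset.sum_congr rfl fun l _ => by ring

theorem two_mul_det_mix [Fintype ι] [DecidableEq ι] {M : ι → Matrix (Fin 2) (Fin 2) ℂ} {l : ι → ℂ}
    (hg : gram M = Matrix.diagonal l) (U : Matrix κ ι ℂ) (k : κ) :
    2 * (mix U M k).det = ∑ j, U k j ^ 2 * l j := by
  have hgram : 2 * (mix U M k).det = gram (mix U M) k k := (polarDet_self _).symm
  rw [hgram, gram_mix, hg, Matrix.mul_apply]
  simp only [Matrix.mul_diagonal, Matrix.transpose_apply]
  exact Finset.sum_congr rfl fun j _ => by ring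

end PolarDet

section PolygonInequality

variable {ι κ : Type*} [Fintype ι]

theorem exists_eq_mix_of_slicesState_eq {α β : Type*} [Finite α] [Finite β] [Fintype κ]
    {M : ι → Matrix α β ℂ} {P : κ → Matrix α β ℂ} (h : slicesState M = slicesState P) :
    ∃ c : Matrix κ ι ℂ, P = mix c M := by
  have hmem : ∀ s, P s ∈ Submodule.span ℂ (Set.range M) := fun s =>
    span_range_le_of_slicesState_eq h (Submodule.subset_span ⟨s, rfl⟩)
  choose c hc using fun s => (Submodule.mem_span_range_iff_exists_fun ℂ).1 (hmem s)
  exact ⟨Matrix.of c, funext fun s => (hc s).symm⟩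

theorem mul_sum_norm_sq_of_gram_eq_diagonal [DecidableEq ι] [Fintype κ]
    {M : ι → Matrix (Fin 2) (Fin 2) ℂ}
    {l : ι → ℝ} (hg : gram M = Matrix.diagonal fun i => (l i : ℂ)) {c : Matrix κ ι ℂ}
    (hc : slicesState M = slicesState (mix c M)) (i : ι) :
    l i * ∑ s, ‖c s i‖ ^ 2 = l i := by
  have hM : ∀ j, polarDet (M i) (M j) = if i = j then (l i : ℂ) else 0 := fun j =>
    congrFun (congrFun hg i) j
  have hmix : ∀ s, polarDet (M i) (mix c M s) = c s i * l i := fun s => by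
    simp [mix, hM]
  have hnorm := sum_norm_sq_eq_of_slicesState_eq hc (polarDet (M i))
  simp only [hmix, hM, apply_ite norm, norm_zero, ite_pow, zero_pow two_ne_zero, norm_mul, mul_pow,
    Complex.norm_real, Real.norm_eq_abs, sq_abs, Finset.sum_ite_eq, Finset.mem_univ, if_true]
    at hnorm
  by_cases hl : l i = 0
  · rw [hl, zero_mul]
  · refine mul_left_cancel₀ hl ?_
    rw [← sq, hnorm, ← Finset.sum_mul]
    ring

theorem two_mul_le_sum_of_isSeparable [DecidableEq ι] {M : ι → Matrix (Fin 2) (Fin 2) ℂ}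
    {l : ι → ℝ} (h0 : ∀ i, 0 ≤ l i) (hg : gram M = Matrix.diagonal fun i => (l i : ℂ))
    (hsep : IsSeparable (slicesState M)) (i : ι) : 2 * l i ≤ ∑ j, l j := by
  obtain ⟨N, μ, ν, hN⟩ := isSeparable_iff.1 hsep
  obtain ⟨c, hc⟩ := exists_eq_mix_of_slicesState_eq hN
  rw [hc] at hN
  have hclose : ∀ s, ∑ j, c s j ^ 2 * (l j : ℂ) = 0 := fun s => by
    rw [← two_mul_det_mix hg, ← hc, Matrix.det_vecMulVec, mul_zero]
  have hpolygon : ∀ s, 2 * (l i * ‖c s i‖ ^ 2) ≤ ∑ j, l j * ‖c s j‖ ^ 2 := fun s => by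
    have hside : ∀ j, ‖c s j ^ 2 * (l j : ℂ)‖ = l j * ‖c s j‖ ^ 2 := fun j => by
      rw [norm_mul, norm_pow, Complex.norm_real, Real.norm_of_nonneg (h0 j), mul_comm]
    simpa only [hside] using two_mul_norm_le_sum_norm (hclose s) i
  have hweight := mul_sum_norm_sq_of_gram_eq_diagonal hg hN
  calc 2 * l i = ∑ s, 2 * (l i * ‖c s i‖ ^ 2) := by
        rw [← Finset.mul_sum, ← Finset.mul_sum, hweight]
    _ ≤ ∑ s, ∑ j, l j * ‖c s j‖ ^ 2 := Finset.sum_le_sum fun s _ => hpolygon s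
    _ = ∑ j, l j := by
        rw [Finset.sum_comm]
        exact Finset.sum_congr rfl fun j _ => by rw [← Finset.mul_sum, hweight]

theorem exists_gram_mix_eq_diagonal {n : ℕ} {M : Fin n → Matrix (Fin 2) (Fin 2) ℂ}
    (hsep : IsSeparable (slicesState M)) :
    ∃ V ∈ Matrix.unitaryGroup (Fin n) ℂ, ∃ l : Fin n → ℝ, (∀ i, 0 ≤ l i) ∧
      (gram (mix V M) = Matrix.diagonal fun i => (l i : ℂ)) ∧ ∀ i, 2 * l i ≤ ∑ j, l j := by
  obtain ⟨V, hV, l, h0, hl⟩ := exists_unitary_mul_mul_transpose_eq_diagonal (gram_isSymm M)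
  rw [← gram_mix] at hl
  exact ⟨V, hV, l, h0, hl, two_mul_le_sum_of_isSeparable h0 hl (by rwa [slicesState_mix hV])⟩

end PolygonInequality

section ProductSlices

theorem submatrix_mem_unitaryGroup {ι κ : Type*} [Fintype ι] [DecidableEq ι] [Fintype κ]
    [DecidableEq κ] {U : Matrix ι ι ℂ} (hU : U ∈ Matrix.unitaryGroup ι ℂ) (e e' : κ ≃ ι) :
    U.submatrix e e' ∈ Matrix.unitaryGroup κ ℂ := by
  rw [Matrix.mem_unitaryGroup_iff, Matrix.star_eq_conjTranspose] at hU ⊢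
  rw [Matrix.conjTranspose_submatrix, Matrix.submatrix_mul_equiv, hU, Matrix.submatrix_one_equiv]

theorem diagonal_mem_unitaryGroup {ι : Type*} [Fintype ι] [DecidableEq ι] {e : ι → ℂ}
    (he : ∀ i, ‖e i‖ = 1) : Matrix.diagonal e ∈ Matrix.unitaryGroup ι ℂ := by
  rw [Matrix.mem_unitaryGroup_iff, Matrix.star_eq_conjTranspose, Matrix.diagonal_conjTranspose,
    Matrix.diagonal_mul_diagonal, ← Matrix.diagonal_one]
  exact congrArg Matrix.diagonal (funext fun i => by simp [Complex.mul_conj', he])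

theorem exists_unitary_sq_eq_one_quarter :
    ∃ H ∈ Matrix.unitaryGroup (Fin 4) ℂ, ∀ k j, H k j ^ 2 = 1 / 4 := by
  let H : Matrix (Fin 4) (Fin 4) ℂ :=
    (1 / 2 : ℂ) • !![1, 1, 1, 1; 1, 1, -1, -1; 1, -1, 1, -1; 1, -1, -1, 1]
  refine ⟨H, Matrix.mem_unitaryGroup_iff.2 ?_, fun k j => ?_⟩
  · have hconj : (starRingEnd ℂ) 2 = 2 := map_ofNat _ 2
    ext i j
    fin_cases i <;> fin_cases j <;>
      simp [H, Matrix.mul_apply, Fin.sum_univ_four, Matrix.star_apply, hconj] <;> norm_num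
  · fin_cases k <;> fin_cases j <;> simp [H] <;> norm_num

theorem exists_unitary_sq_add_sq_eq_zero :
    ∃ H ∈ Matrix.unitaryGroup (Fin 3) ℂ, ∀ k, H k 0 ^ 2 + H k 1 ^ 2 = 0 := by
  obtain ⟨s, hs⟩ : ∃ s : ℝ, s ^ 2 = 1 / 2 := ⟨√(1 / 2), Real.sq_sqrt (by norm_num)⟩
  have hs' : (s : ℂ) ^ 2 = 1 / 2 := by
    rw [← Complex.ofReal_pow, hs]
    norm_num
  let H : Matrix (Fin 3) (Fin 3) ℂ :=
    !![(s : ℂ), Complex.I * s, 0; (s : ℂ), -(Complex.I * s), 0; 0, 0, 1]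
  refine ⟨H, Matrix.mem_unitaryGroup_iff.2 ?_, fun k => ?_⟩
  · ext i j
    fin_cases i <;> fin_cases j <;>
      simp [H, Matrix.mul_apply, Fin.sum_univ_three, Matrix.star_apply] <;>
      grind [Complex.I_sq]
  · fin_cases k <;> simp [H, mul_pow]

theorem exists_mix_det_eq_zero_of_four {M : Fin 4 → Matrix (Fin 2) (Fin 2) ℂ}
    (hsep : IsSeparable (slicesState M)) :
    ∃ U ∈ Matrix.unitaryGroup (Fin 4) ℂ, ∀ k, (mix U M k).det = 0 := by
  obtain ⟨V, hV, l, h0, hl, hpolygon⟩ := exists_gram_mix_eq_diagonal hsep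
  obtain ⟨u, hu, hsum⟩ := exists_norm_one_sum_mul_eq_zero h0 hpolygon
  choose e he hsq using fun i => exists_sq_eq_of_norm_eq_one (hu i)
  obtain ⟨H, hH, hquarter⟩ := exists_unitary_sq_eq_one_quarter
  refine ⟨H * Matrix.diagonal e * V, mul_mem (mul_mem hH (diagonal_mem_unitaryGroup he)) hV,
    fun k => ?_⟩
  have htwo : 2 * (mix (H * Matrix.diagonal e) (mix V M) k).det = 1 / 4 * ∑ j, l j * u j := by
    rw [two_mul_det_mix hl, Finset.mul_sum]
    refine Finset.sum_congr rfl fun j _ => ?_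
    rw [Matrix.mul_diagonal, mul_pow, hquarter, hsq]
    ring
  rw [← mix_mix]
  simpa [hsum] using htwo

theorem exists_mix_det_eq_zero_of_three {M : Fin 3 → Matrix (Fin 2) (Fin 2) ℂ}
    (hsep : IsSeparable (slicesState M)) (hdet : (gram M).det = 0) :
    ∃ U ∈ Matrix.unitaryGroup (Fin 3) ℂ, ∀ k, (mix U M k).det = 0 := by
  obtain ⟨V, hV, l, -, hl, hpolygon⟩ := exists_gram_mix_eq_diagonal hsep
  obtain ⟨i, hi⟩ : ∃ i, l i = 0 := by
    have hprod := congrArg Matrix.det hl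
    rw [gram_mix, Matrix.det_mul, Matrix.det_mul, hdet, mul_zero, zero_mul,
      Matrix.det_diagonal, ← Complex.ofReal_prod, eq_comm, Complex.ofReal_eq_zero] at hprod
    simpa using Finset.prod_eq_zero_iff.1 hprod
  let σ : Equiv.Perm (Fin 3) := Equiv.swap i 2
  have hzero : l (σ 2) = 0 := by rwa [Equiv.swap_apply_right]
  -- the polygon degenerates to a segment and back
  have hequal : l (σ 0) = l (σ 1) := by
    have h01 : ∀ j, 2 * l j ≤ l (σ 0) + l (σ 1) := fun j => by
      simpa [← Equiv.sum_comp σ l, Fin.sum_univ_three, hzero] using hpolygon j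
    linarith [h01 (σ 0), h01 (σ 1)]
  obtain ⟨H, hH, hHsq⟩ := exists_unitary_sq_add_sq_eq_zero
  refine ⟨H.submatrix (Equiv.refl _) σ.symm * V,
    mul_mem (submatrix_mem_unitaryGroup hH _ _) hV, fun k => ?_⟩
  have htwo := two_mul_det_mix hl (H.submatrix (Equiv.refl _) σ.symm) k
  rw [← Equiv.sum_comp σ, Fin.sum_univ_three] at htwo
  simp only [Matrix.submatrix_apply, Equiv.refl_apply, Equiv.symm_apply_apply, hzero, hequal,
    Complex.ofReal_zero, mul_zero, add_zero, ← add_mul, hHsq, zero_mul] at htwo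
  rw [← mix_mix]
  simpa using htwo

end ProductSlices

section RankFour

theorem exists_ofSlices_eq_image {m m' n : ℕ} {β : Type*} [Fintype β] [DecidableEq β]
    {M : Fin n → Matrix (Fin m) β ℂ} {N : Fin n → Matrix (Fin m') β ℂ}
    {U : Matrix (Fin n) (Fin n) ℂ} (hU : U ∈ Matrix.unitaryGroup (Fin n) ℂ)
    (σ : Equiv.Perm (Fin n)) {W : Matrix (Fin m) (Fin m') ℂ} {R : Matrix β β ℂ}
    (hR : IsUnit R.det) (h : ∀ j, mix U M (σ j) = W * N j * R) :
    ∃ U' ∈ Matrix.unitaryGroup (Fin n) ℂ, ofSlices M = image W U' (ofSlices N) := by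
  have hUσ := submatrix_mem_unitaryGroup hU σ (Equiv.refl _)
  let U' := star (U.submatrix σ (Equiv.refl _))
  have hmix : (fun j => W * N j * R) = mix (U.submatrix σ (Equiv.refl _)) M :=
    funext fun j => (h j).symm
  refine ⟨U', Unitary.star_mem hUσ, ?_⟩
  calc ofSlices M = ofSlices (mix U' fun j => W * N j * R) := by
        rw [hmix, mix_mix, Matrix.mem_unitaryGroup_iff'.1 hUσ, mix_one]
    _ = ofSlices fun j => W * mix U' N j * R := by
        refine congrArg ofSlices (funext fun j => ?_)
        simp only [mix, Matrix.mul_sum, Matrix.sum_mul, Matrix.mul_smul, Matrix.smul_mul]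
    _ = image W U' (ofSlices N) := by rw [ofSlices_mul _ hR, image_ofSlices]

theorem eq_zero_of_forall_polarDet_eq_zero {X : Matrix (Fin 2) (Fin 2) ℂ}
    (hX : ∀ Y, polarDet X Y = 0) : X = 0 := by
  ext i j
  have hcofactor := hX (Matrix.single (i + 1) (j + 1) 1)
  fin_cases i <;> fin_cases j <;> simpa [polarDet_apply, Matrix.single_apply] using hcofactor

theorem exists_polarDet_ne_zero {ι : Type*} {M : ι → Matrix (Fin 2) (Fin 2) ℂ}
    (hM : Submodule.span ℂ (Set.range M) = ⊤) {X : Matrix (Fin 2) (Fin 2) ℂ} (hX : X ≠ 0) :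
    ∃ i, polarDet X (M i) ≠ 0 := by
  by_contra! h
  refine hX (eq_zero_of_forall_polarDet_eq_zero fun Y => ?_)
  have hker : Submodule.span ℂ (Set.range M) ≤ LinearMap.ker (polarDet X) :=
    Submodule.span_le.2 (Set.range_subset_iff.2 h)
  exact hker (hM ▸ Submodule.mem_top)

theorem ofSlices_fin_two {m n : ℕ} (M : Fin n → Matrix (Fin m) (Fin 2) ℂ) :
    ofSlices M = Submodule.span ℂ {sliceCol M 0, sliceCol M 1} := by
  rw [ofSlices]
  congr 1
  ext v
  simp [Fin.exists_fin_two, eq_comm]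

theorem model4_eq_ofSlices (a b c d : Fin 2 → ℂ) : model4 a b c d = ofSlices fun j =>
    Matrix.vecMulVec (![![1, 0], ![0, 1], a, c] j) (![![1, 0], ![0, 1], b, d] j) := by
  rw [ofSlices_fin_two, model4]
  congr 2
  · ext ⟨i, j⟩
    fin_cases i <;> fin_cases j <;> simp [sliceCol, ket, Matrix.vecMulVec_apply, mul_comm]
  · congr 1
    ext ⟨i, j⟩
    fin_cases i <;> fin_cases j <;> simp [sliceCol, ket, Matrix.vecMulVec_apply] <;> ring

theorem finrank_model4 (a b c d : Fin 2 → ℂ) : Module.finrank ℂ (model4 a b c d) = 2 := by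
  rw [model4_eq_ofSlices, finrank_ofSlices_eq_iff, Fintype.linearIndependent_iff]
  intro g hg
  rw [sum_smul_sliceCol_eq_zero_iff] at hg
  have h0 : g 0 = 0 := by
    simpa [Matrix.mulVec, Matrix.vecMulVec_apply, dotProduct] using congrFun (hg 0) 0
  have h1 : g 1 = 0 := by
    simpa [Matrix.mulVec, Matrix.vecMulVec_apply, dotProduct] using congrFun (hg 1) 1
  exact Fin.forall_fin_two.2 ⟨h0, h1⟩

theorem rankB_model4_eq_four_iff (a b c d : Fin 2 → ℂ) : rankB (model4 a b c d) = 4 ↔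
    Matrix.det !![a 0 * b 1, a 1 * b 0; c 0 * d 1, c 1 * d 0] ≠ 0 := by
  let D := !![a 0 * b 1, a 1 * b 0; c 0 * d 1, c 1 * d 0]
  have hrel : ∀ g : Fin 4 → ℂ, ∑ j, g j •
      Matrix.vecMulVec (![![1, 0], ![0, 1], a, c] j) (![![1, 0], ![0, 1], b, d] j) = 0 ↔
      ![g 2, g 3] ᵥ* D = 0 ∧ g 0 = -(g 2 * (a 0 * b 0) + g 3 * (c 0 * d 0))
        ∧ g 1 = -(g 2 * (a 1 * b 1) + g 3 * (c 1 * d 1)) := fun g => by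
    simp [← Matrix.ext_iff, funext_iff, Fin.sum_univ_four, Matrix.vecMulVec_apply, D,
      Fin.forall_fin_two]
    grind
  rw [model4_eq_ofSlices, rankB_ofSlices_eq_iff, Fintype.linearIndependent_iff, Ne,
    ← Matrix.exists_vecMul_eq_zero_iff (M := D)]
  simp only [hrel]
  constructor
  · rintro h ⟨v, hv, hvD⟩
    have hv2 : ![v 0, v 1] = v := by
      ext i
      fin_cases i <;> rfl
    have hv0 := h ![-(v 0 * (a 0 * b 0) + v 1 * (c 0 * d 0)),
      -(v 0 * (a 1 * b 1) + v 1 * (c 1 * d 1)), v 0, v 1] ⟨hv2 ▸ hvD, rfl, rfl⟩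
    exact hv (funext (Fin.forall_fin_two.2 ⟨hv0 2, hv0 3⟩))
  · rintro h g ⟨hD, h0, h1⟩
    have hg : ![g 2, g 3] = 0 := by
      by_contra hne
      exact h ⟨_, hne, hD⟩
    have h2 : g 2 = 0 := congrFun hg 0
    have h3 : g 3 = 0 := congrFun hg 1
    simp [Fin.forall_fin_succ, h0, h1, h2, h3]

theorem exists_forall_eq_mulVec (μ : Fin 4 → Fin 2 → ℂ)
    (hμ : Matrix.det !![μ 0 0, μ 1 0; μ 0 1, μ 1 1] ≠ 0) :
    ∃ a c, ∀ j, μ j = !![μ 0 0, μ 1 0; μ 0 1, μ 1 1] *ᵥ ![![1, 0], ![0, 1], a, c] j := by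
  have hinv : ∀ z, z = !![μ 0 0, μ 1 0; μ 0 1, μ 1 1] *ᵥ
      (!![μ 0 0, μ 1 0; μ 0 1, μ 1 1]⁻¹ *ᵥ z) := fun z => by
    rw [Matrix.mulVec_mulVec, Matrix.mul_nonsing_inv _ hμ.isUnit, Matrix.one_mulVec]
  refine ⟨_, _, Fin.forall_fin_succ.2 ⟨?_, Fin.forall_fin_succ.2 ⟨?_, Fin.forall_fin_two.2
    ⟨hinv _, hinv _⟩⟩⟩⟩ <;> ext i <;> fin_cases i <;> simp

theorem exists_ebEquivalent_model4 {M : Fin 4 → Matrix (Fin 2) (Fin 2) ℂ}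
    (hM : LinearIndependent ℂ M) {U : Matrix (Fin 4) (Fin 4) ℂ}
    (hU : U ∈ Matrix.unitaryGroup (Fin 4) ℂ) (h0 : ∀ k, (mix U M k).det = 0) :
    ∃ a b c d : Fin 2 → ℂ, EBEquivalent (model4 a b c d) (ofSlices M) := by
  have hspan : Submodule.span ℂ (Set.range (mix U M)) = ⊤ := by
    rw [span_range_mix (isUnit_det_of_mem_unitaryGroup hU)]
    exact hM.span_eq_top_of_card_eq_finrank' (by simp [Module.finrank_matrix])
  have hne : mix U M 0 ≠ 0 :=
    (linearIndependent_of_top_le_span_of_card_eq_finrank hspan.ge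
      (by simp [Module.finrank_matrix])).ne_zero 0
  obtain ⟨t, ht⟩ := exists_polarDet_ne_zero hspan hne
  have ht0 : t ≠ 0 := by
    rintro rfl
    rw [polarDet_self, h0, mul_zero] at ht
    exact ht rfl
  let σ : Equiv.Perm (Fin 4) := Equiv.swap 1 t
  choose μ ν hμν using fun j => exists_eq_vecMulVec (h0 (σ j))
  have hσ0 : σ 0 = 0 := Equiv.swap_apply_of_ne_of_ne zero_ne_one ht0.symm
  have hσ1 : σ 1 = t := Equiv.swap_apply_left 1 t
  rw [← hσ0, ← hσ1, hμν, hμν, polarDet_vecMulVec, mul_ne_zero_iff] at ht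
  obtain ⟨a, c, hμ⟩ := exists_forall_eq_mulVec μ ht.1
  have hdet : Matrix.det !![ν 0 0, ν 1 0; ν 0 1, ν 1 1] ≠ 0 := by
    simpa [Matrix.det_fin_two, mul_comm] using ht.2
  obtain ⟨b, d, hν⟩ := exists_forall_eq_mulVec ν hdet
  obtain ⟨U', hU', h⟩ := exists_ofSlices_eq_image
    (N := fun j => Matrix.vecMulVec (![![1, 0], ![0, 1], a, c] j) (![![1, 0], ![0, 1], b, d] j))
    (W := !![μ 0 0, μ 1 0; μ 0 1, μ 1 1]) (R := !![ν 0 0, ν 1 0; ν 0 1, ν 1 1]ᵀ) hU σ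
    (Matrix.isUnit_det_transpose _ hdet.isUnit) fun j => by
      rw [hμν, Matrix.mul_vecMulVec, Matrix.vecMulVec_mul, ← hμ, Matrix.vecMul_transpose, ← hν]
  refine ⟨a, b, c, d, _, U', (Matrix.isUnit_iff_isUnit_det _).2 ht.1.isUnit, hU', ?_⟩
  rw [h, model4_eq_ofSlices]

theorem isEB_rankB_four_iff (T : Submodule ℂ (Bip 2 4)) :
    (Module.finrank ℂ T = 2 ∧ IsEB T ∧ rankB T = 4) ↔
      ∃ a b c d : Fin 2 → ℂ, Matrix.det !![a 0 * b 1, a 1 * b 0; c 0 * d 1, c 1 * d 0] ≠ 0 ∧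
        EBEquivalent (model4 a b c d) T := by
  constructor
  · rintro ⟨hT, hEB, hrank⟩
    obtain ⟨M, rfl, -⟩ := exists_eq_ofSlices T hT
    obtain ⟨U, hU, h0⟩ := exists_mix_det_eq_zero_of_four (isEB_ofSlices.1 hEB)
    obtain ⟨a, b, c, d, hequiv⟩ :=
      exists_ebEquivalent_model4 (rankB_ofSlices_eq_iff.1 hrank) hU h0
    refine ⟨a, b, c, d, (rankB_model4_eq_four_iff a b c d).1 ?_, hequiv⟩
    obtain ⟨W, U', hW, hU', heq⟩ := hequiv
    rwa [heq, rankB_image ((Matrix.isUnit_iff_isUnit_det _).1 hW)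
      (isUnit_det_of_mem_unitaryGroup hU')] at hrank
  · rintro ⟨a, b, c, d, hdet, W, U, hW, hU, rfl⟩
    rw [Matrix.isUnit_iff_isUnit_det] at hW
    have hUdet := isUnit_det_of_mem_unitaryGroup hU
    have hEB : IsEB (model4 a b c d) := by
      rw [model4_eq_ofSlices]
      exact isEB_ofSlices_vecMulVec _ _
    refine ⟨?_, hEB.image W hU, ?_⟩
    · rw [finrank_image hW hUdet, finrank_model4]
    · rwa [rankB_image hW hUdet, rankB_model4_eq_four_iff]

end RankFour

section RankThree

/-- The slices `|k⟩⟨e k|`, which describe the model spaces of `ℂ^3 ⊗ ℂ^3` spanned by diagonal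
vectors. -/
def diagSlices {κ : Type*} [DecidableEq κ] {β : Type*} (e : κ → β → ℂ) : κ → Matrix κ β ℂ :=
  fun k => Matrix.vecMulVec (Pi.single k 1) (e k)

theorem ofSlices_diagSlices_eq_span_ket : ofSlices (diagSlices ![![1, 0], ![0, 1], ![0, 1]]) =
    Submodule.span ℂ {ket (0 : Fin 3) (0 : Fin 3), ket 1 1 + ket 2 2} := by
  rw [ofSlices_fin_two]
  congr 2
  · ext ⟨i, j⟩
    fin_cases i <;> fin_cases j <;> simp [diagSlices, sliceCol, ket, Matrix.vecMulVec_apply]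
  · congr 1
    ext ⟨i, j⟩
    fin_cases i <;> fin_cases j <;> simp [diagSlices, sliceCol, ket, Matrix.vecMulVec_apply]

theorem ofSlices_diagSlices_eq_span_ket_add_ket :
    ofSlices (diagSlices ![![1, 0], ![1, 1], ![0, 1]]) =
      Submodule.span ℂ {ket (0 : Fin 3) (0 : Fin 3) + ket 1 1, ket 1 1 + ket 2 2} := by
  rw [ofSlices_fin_two]
  congr 2
  · ext ⟨i, j⟩
    fin_cases i <;> fin_cases j <;> simp [diagSlices, sliceCol, ket, Matrix.vecMulVec_apply]
  · congr 1
    ext ⟨i, j⟩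
    fin_cases i <;> fin_cases j <;> simp [diagSlices, sliceCol, ket, Matrix.vecMulVec_apply]

theorem ebConvertible_diagSlices {m n r : ℕ} {M : Fin n → Matrix (Fin m) (Fin r) ℂ}
    {U : Matrix (Fin n) (Fin n) ℂ} (hU : U ∈ Matrix.unitaryGroup (Fin n) ℂ)
    {μ : Fin n → Fin m → ℂ} {ν : Fin n → Fin r → ℂ}
    (hμν : ∀ k, mix U M k = Matrix.vecMulVec (μ k) (ν k)) (σ : Equiv.Perm (Fin n)) {c : Fin n → ℂ}
    {R : Matrix (Fin r) (Fin r) ℂ} (hR : IsUnit R.det) {e : Fin n → Fin r → ℂ}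
    (he : ∀ k, ν (σ k) = c k • (e k ᵥ* R)) :
    EBConvertible (ofSlices (diagSlices e)) (ofSlices M) := by
  obtain ⟨U', hU', h⟩ := exists_ofSlices_eq_image (N := diagSlices e)
    (W := Matrix.of fun a k => c k * μ (σ k) a) hU σ hR fun k => by
      rw [hμν, he, diagSlices, Matrix.mul_vecMulVec, Matrix.vecMulVec_mul]
      ext a b
      simp [Matrix.vecMulVec_apply]
      ring
  exact ⟨_, U', hU', h⟩

theorem exists_eq_smul_vecMul_diagSlices {ν : Fin 3 → Fin 2 → ℂ}
    (hdet : (Matrix.of ![ν 0, ν 1]).det ≠ 0) :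
    ∃ (e : Fin 3 → Fin 2 → ℂ) (σ : Equiv.Perm (Fin 3)) (c : Fin 3 → ℂ)
      (R : Matrix (Fin 2) (Fin 2) ℂ), IsModel3 (ofSlices (diagSlices e)) ∧ IsUnit R.det ∧
        ∀ k, ν (σ k) = c k • (e k ᵥ* R) := by
  obtain ⟨x, y, hxy⟩ : ∃ x y : ℂ, ν 2 = x • ν 0 + y • ν 1 := by
    let z := ν 2 ᵥ* (Matrix.of ![ν 0, ν 1])⁻¹
    have hz : ν 2 = z ᵥ* Matrix.of ![ν 0, ν 1] := by
      rw [Matrix.vecMul_vecMul, Matrix.nonsing_inv_mul _ hdet.isUnit, Matrix.vecMul_one]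
    exact ⟨z 0, z 1, by rw [hz, Matrix.vecMul_eq_sum, Fin.sum_univ_two]; rfl⟩
  have hparallel : IsModel3 _ := Or.inl ofSlices_diagSlices_eq_span_ket
  by_cases hx : x = 0
  · refine ⟨_, Equiv.refl _, ![1, 1, y], _, hparallel, hdet.isUnit, Fin.forall_fin_succ.2
      ⟨?_, Fin.forall_fin_two.2 ⟨?_, ?_⟩⟩⟩ <;> simp [hxy, hx]
  by_cases hy : y = 0
  · have hdet' : (Matrix.of ![ν 1, ν 0]).det ≠ 0 := by
      simpa [Matrix.det_fin_two, sub_eq_zero, mul_comm, eq_comm (a := ν 0 0 * ν 1 1)] using hdet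
    have hswap : Equiv.swap (0 : Fin 3) 1 2 = 2 := rfl
    refine ⟨_, Equiv.swap 0 1, ![1, 1, x], _, hparallel, hdet'.isUnit, Fin.forall_fin_succ.2
      ⟨?_, Fin.forall_fin_two.2 ⟨?_, ?_⟩⟩⟩ <;> simp [hswap, hxy, hy]
  have hdet' : (Matrix.of ![x • ν 0, y • ν 1]).det = x * y * (Matrix.of ![ν 0, ν 1]).det := by
    rw [Matrix.det_fin_two, Matrix.det_fin_two]
    simp only [Matrix.of_apply, Matrix.cons_val_zero, Matrix.cons_val_one, Pi.smul_apply,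
      smul_eq_mul]
    ring
  have hswap : Equiv.swap (1 : Fin 3) 2 0 = 0 := rfl
  refine ⟨_, Equiv.swap 1 2, ![x⁻¹, 1, y⁻¹], Matrix.of ![x • ν 0, y • ν 1],
    Or.inr (Or.inl ofSlices_diagSlices_eq_span_ket_add_ket), ?_,
    Fin.forall_fin_succ.2 ⟨?_, Fin.forall_fin_two.2 ⟨?_, ?_⟩⟩⟩
  · rw [hdet']
    exact (mul_ne_zero (mul_ne_zero hx hy) hdet).isUnit
  all_goals simp [hswap, hxy, hx, hy]

theorem exists_det_ne_zero_of_linearIndependent {m n : ℕ} {μ : Fin n → Fin m → ℂ}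
    {ν : Fin n → Fin 2 → ℂ}
    (h : LinearIndependent ℂ (sliceCol fun j => Matrix.vecMulVec (μ j) (ν j))) :
    ∃ i j, (Matrix.of ![ν i, ν j]).det ≠ 0 := by
  rw [Fintype.linearIndependent_iff] at h
  simp only [sum_smul_sliceCol_eq_zero_iff] at h
  by_contra! hdet
  have hν : ∀ i, ν i = 0 := fun i => by
    have hi := h ![ν i 1, -ν i 0] fun j => by
      have hdot : ν j ⬝ᵥ ![ν i 1, -ν i 0] = -(Matrix.of ![ν i, ν j]).det := by
        simp [Matrix.det_fin_two, dotProduct]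
        ring
      rw [Matrix.vecMulVec_mulVec, hdot, hdet, neg_zero, MulOpposite.op_zero, zero_smul]
    ext a
    fin_cases a
    · simpa using hi 1
    · simpa using hi 0
  simpa using h ![1, 0] (by simp [hν, Matrix.vecMulVec_mulVec]) 0

theorem exists_isModel3_ebConvertible_of_mix_det_eq_zero {M : Fin 3 → Matrix (Fin 2) (Fin 2) ℂ}
    (hM : LinearIndependent ℂ (sliceCol M)) {U : Matrix (Fin 3) (Fin 3) ℂ}
    (hU : U ∈ Matrix.unitaryGroup (Fin 3) ℂ) (h0 : ∀ k, (mix U M k).det = 0) :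
    ∃ S, IsModel3 S ∧ EBConvertible S (ofSlices M) := by
  choose μ ν hμν using fun k => exists_eq_vecMulVec (h0 k)
  have himage : image 1 U (ofSlices M) = ofSlices fun k => Matrix.vecMulVec (μ k) (ν k) := by
    simp only [image_ofSlices, Matrix.one_mul, hμν]
  have hLI : LinearIndependent ℂ (sliceCol fun k => Matrix.vecMulVec (μ k) (ν k)) := by
    rwa [← finrank_ofSlices_eq_iff, ← himage, finrank_image (by simp)
      (isUnit_det_of_mem_unitaryGroup hU), finrank_ofSlices_eq_iff]
  obtain ⟨i, j, hij⟩ := exists_det_ne_zero_of_linearIndependent hLI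
  have hne : i ≠ j := by
    rintro rfl
    exact hij (Matrix.det_zero_of_row_eq zero_ne_one rfl)
  obtain ⟨τ, rfl, rfl⟩ : ∃ τ : Equiv.Perm (Fin 3), τ 0 = i ∧ τ 1 = j := by
    clear hij
    revert i j
    decide
  obtain ⟨e, σ, c, R, hS, hR, he⟩ := exists_eq_smul_vecMul_diagSlices (ν := ν ∘ τ) hij
  exact ⟨_, hS, ebConvertible_diagSlices hU hμν (τ * σ) hR he⟩

end RankThree

section TriSlices

theorem exists_det_ne_zero_forall_polarDet_eq_zero {M : Fin 3 → Matrix (Fin 2) (Fin 2) ℂ}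
    (hM : (gram M).det ≠ 0) : ∃ N, N.det ≠ 0 ∧ ∀ j, polarDet (M j) N = 0 := by
  let pairing := LinearMap.pi fun j => polarDet (M j)
  obtain ⟨N, hN, hN0⟩ := (LinearMap.ker pairing).exists_mem_ne_zero_of_ne_bot
    (LinearMap.ker_ne_bot_of_finrank_lt (by simp [Module.finrank_matrix]))
  have horth : ∀ j, polarDet (M j) N = 0 := congrFun hN
  have hcoeff : ∀ c : Fin 3 → ℂ, (∀ i, polarDet (M i) (∑ j, c j • M j) = 0) → c = 0 := fun c hc =>
    Matrix.eq_zero_of_mulVec_eq_zero hM <| funext fun i => by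
      simpa [gram, Matrix.mulVec, dotProduct, mul_comm] using hc i
  have hLI : LinearIndependent ℂ (Fin.cons N M : Fin 4 → Matrix (Fin 2) (Fin 2) ℂ) := by
    refine linearIndependent_finCons.2 ⟨Fintype.linearIndependent_iff.2 fun c hc =>
      congrFun (hcoeff c (by simp [hc])), fun hmem => hN0 ?_⟩
    obtain ⟨c, rfl⟩ := (Submodule.mem_span_range_iff_exists_fun ℂ).1 hmem
    simp [hcoeff c horth]
  obtain ⟨i, hi⟩ := exists_polarDet_ne_zero
    (hLI.span_eq_top_of_card_eq_finrank' (by simp [Module.finrank_matrix])) hN0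
  refine ⟨N, fun hdet => hi ?_, horth⟩
  refine Fin.cases ?_ (fun j => ?_) i
  · rw [Fin.cons_zero, polarDet_self, hdet, mul_zero]
  · rw [Fin.cons_succ, polarDet_comm, horth]

theorem polarDet_mul (X X' Y : Matrix (Fin 2) (Fin 2) ℂ) :
    polarDet (X * Y) (X' * Y) = Y.det * polarDet X X' := by
  simp only [polarDet_apply, Matrix.det_fin_two, Matrix.mul_apply, Fin.sum_univ_two]
  ring

theorem exists_forall_isSymm_mul {M : Fin 3 → Matrix (Fin 2) (Fin 2) ℂ}
    (hM : (gram M).det ≠ 0) :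
    ∃ Y : Matrix (Fin 2) (Fin 2) ℂ, Y.det ≠ 0 ∧ ∀ j, (M j * Y).IsSymm := by
  obtain ⟨N, hN, horth⟩ := exists_det_ne_zero_forall_polarDet_eq_zero hM
  refine ⟨!![N 0 1, N 1 1; -N 0 0, -N 1 0], ?_, fun j => ?_⟩
  · convert hN using 1
    rw [Matrix.det_fin_two_of, Matrix.det_fin_two]
    ring
  · -- the two off-diagonal entries of `M j * Y` differ by `polarDet (M j) N`
    have hoff := horth j
    rw [polarDet_apply] at hoff
    refine Matrix.IsSymm.ext fun a b => ?_
    fin_cases a <;> fin_cases b <;> simp [Matrix.mul_apply] <;> grind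

/-- The symmetric matrix with upper triangular entries `x`. -/
def symMatrix (x : Fin 3 → ℂ) : Matrix (Fin 2) (Fin 2) ℂ :=
  !![x 0, x 1; x 1, x 2]

theorem symMatrix_apply_eq_self {X : Matrix (Fin 2) (Fin 2) ℂ} (hX : X.IsSymm) :
    symMatrix ![X 0 0, X 0 1, X 1 1] = X := by
  ext a b
  fin_cases a <;> fin_cases b <;> simp [symMatrix, hX.apply 0 1]

theorem mix_symMatrix {ι κ : Type*} [Fintype ι] (U : Matrix κ ι ℂ) (K : Matrix ι (Fin 3) ℂ)
    (j : κ) : mix U (fun i => symMatrix (K i)) j = symMatrix ((U * K) j) := by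
  ext a b
  fin_cases a <;> fin_cases b <;> simp [mix_apply, symMatrix, Matrix.mul_apply]

theorem gram_symMatrix {ι : Type*} (K : Matrix ι (Fin 3) ℂ) :
    gram (fun i => symMatrix (K i)) = K * (!![0, 0, 1; 0, -2, 0; 1, 0, 0] : Matrix _ _ ℂ) * Kᵀ := by
  ext i j
  simp [gram, polarDet_apply, symMatrix, Matrix.mul_apply, Fin.sum_univ_three]
  ring

theorem exists_unitary_mul_isUpperTriangular {n : ℕ} (K : Matrix (Fin n) (Fin n) ℂ) :
    ∃ U ∈ Matrix.unitaryGroup (Fin n) ℂ, (U * K).IsUpperTriangular := by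
  let f : Fin n → EuclideanSpace ℂ (Fin n) := fun j => WithLp.toLp 2 (K.col j)
  let b := InnerProductSpace.gramSchmidtOrthonormalBasis (𝕜 := ℂ) (by simp) f
  refine ⟨_, Matrix.map_star_mem_unitaryGroup_iff.2
    (of_mem_unitaryGroup_of_orthonormal b.orthonormal), fun i j hij => ?_⟩
  have h : inner ℂ (b i) (f j) = 0 :=
    InnerProductSpace.gramSchmidtOrthonormalBasis_inv_triangular (by simp) f hij
  rw [← h, EuclideanSpace.inner_eq_star_dotProduct, dotProduct_comm]
  rfl

theorem exists_mix_eq_of_isSymm {S : Fin 3 → Matrix (Fin 2) (Fin 2) ℂ} (hS : ∀ j, (S j).IsSymm)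
    (hdet : (gram S).det ≠ 0) :
    ∃ U ∈ Matrix.unitaryGroup (Fin 3) ℂ, ∃ p q r s t u : ℂ, p ≠ 0 ∧ s ≠ 0 ∧ u ≠ 0 ∧
      mix U S = ![!![p, q; q, r], !![0, s; s, t], !![0, 0; 0, u]] := by
  let K : Matrix (Fin 3) (Fin 3) ℂ := fun j => ![S j 0 0, S j 0 1, S j 1 1]
  have hSK : S = fun j => symMatrix (K j) := funext fun j => (symMatrix_apply_eq_self (hS j)).symm
  obtain ⟨U, hU, htri⟩ := exists_unitary_mul_isUpperTriangular K
  have hne : (U * K).det ≠ 0 := by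
    rw [hSK, gram_symMatrix, Matrix.det_mul, Matrix.det_transpose] at hdet
    rw [Matrix.det_mul]
    exact mul_ne_zero (isUnit_det_of_mem_unitaryGroup hU).ne_zero (right_ne_zero_of_mul hdet)
  rw [Matrix.det_of_isUpperTriangular htri, Fin.prod_univ_three, mul_ne_zero_iff,
    mul_ne_zero_iff] at hne
  refine ⟨U, hU, (U * K) 0 0, (U * K) 0 1, (U * K) 0 2, (U * K) 1 1, (U * K) 1 2, (U * K) 2 2,
    hne.1.1, hne.1.2, hne.2, ?_⟩
  have h10 : (U * K) 1 0 = 0 := htri (by decide)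
  have h20 : (U * K) 2 0 = 0 := htri (by decide)
  have h21 : (U * K) 2 1 = 0 := htri (by decide)
  ext j a b
  rw [hSK, mix_symMatrix]
  fin_cases j <;> simp [symMatrix, h10, h20, h21]

/-- The slices of the third kind of model space of `ℂ^3 ⊗ ℂ^3`, without their zero third row;
`h` stands for `f e^{iθ}`. -/
def triSlices (d g : ℝ) (h : ℂ) : Fin 3 → Matrix (Fin 2) (Fin 2) ℂ :=
  ![!![1, 0; 0, (d : ℂ)], !![0, 1; 1, h], !![0, 0; 0, (g : ℂ)]]

theorem mul_triSlices_mul_transpose (x y z h : ℂ) (d g : ℝ) (j : Fin 3) :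
    !![x, 0; y, z] * triSlices d g h j * !![x, 0; y, z]ᵀ =
      (![!![x ^ 2, x * y; x * y, y ^ 2 + z ^ 2 * d], !![0, x * z; x * z, 2 * y * z + z ^ 2 * h],
        !![0, 0; 0, z ^ 2 * g]] : Fin 3 → Matrix (Fin 2) (Fin 2) ℂ) j := by
  ext a b
  fin_cases j <;> fin_cases a <;> fin_cases b <;> simp [triSlices, Matrix.mul_apply] <;> ring

theorem exists_smul_eq_mul_triSlices_mul {p s u : ℂ} (hp : p ≠ 0) (hs : s ≠ 0) (hu : u ≠ 0)
    (q r t : ℂ) :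
    ∃ (B : Matrix (Fin 2) (Fin 2) ℂ) (e : Fin 3 → ℂ) (d g : ℝ) (h : ℂ), B.det ≠ 0 ∧
      (∀ j, ‖e j‖ = 1) ∧ 0 ≤ d ∧ 0 < g ∧
      ∀ j, e j • (![!![p, q; q, r], !![0, s; s, t], !![0, 0; 0, u]] :
        Fin 3 → Matrix (Fin 2) (Fin 2) ℂ) j = B * triSlices d g h j * Bᵀ := by
  obtain ⟨x, hx, hxp⟩ : ∃ x : ℝ, 0 < x ∧ x ^ 2 = ‖p‖ :=
    ⟨√‖p‖, Real.sqrt_pos.2 (norm_pos_iff.2 hp), Real.sq_sqrt (norm_nonneg p)⟩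
  have hxp' : (x : ℂ) ^ 2 = ‖p‖ := by exact_mod_cast congrArg Complex.ofReal hxp
  let y := x * q / p
  let ρ := x ^ 2 * r / p - y ^ 2
  obtain ⟨ω, hω, hωρ⟩ := Complex.exists_norm_mul_eq_self ρ
  obtain ⟨κ, hκ, hκω⟩ := exists_sq_eq_of_norm_eq_one hω
  let z := κ * (‖s‖ / x)
  have hx0 : (x : ℂ) ≠ 0 := Complex.ofReal_ne_zero.2 hx.ne'
  have hs0 : (‖s‖ : ℂ) ≠ 0 := Complex.ofReal_ne_zero.2 (norm_ne_zero_iff.2 hs)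
  have hκ0 : κ ≠ 0 := norm_ne_zero_iff.1 (hκ ▸ one_ne_zero)
  have hz0 : z ≠ 0 := mul_ne_zero hκ0 (div_ne_zero hs0 hx0)
  refine ⟨!![(x : ℂ), 0; y, z], ![‖p‖ / p, κ * (‖s‖ / s), κ ^ 2 * (‖u‖ / u)],
    ‖ρ‖ * (x / ‖s‖) ^ 2, ‖u‖ * (x / ‖s‖) ^ 2, (κ * (‖s‖ / s) * t - 2 * y * z) / z ^ 2,
    ?_, ?_, by positivity, ?_, ?_⟩
  · simp [Matrix.det_fin_two_of, hx0, hz0]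
  · simp [Fin.forall_fin_succ, hκ, hp, hs, hu]
  · have := norm_pos_iff.2 hs
    have := norm_pos_iff.2 hu
    positivity
  · have hz : x * z = κ * ‖s‖ := by simp only [z]; field_simp
    have hρz : z ^ 2 * (‖ρ‖ * (x / ‖s‖) ^ 2) = ρ := by
      simp only [z]
      field_simp
      rw [hκω, hωρ]
    have huz : z ^ 2 * (‖u‖ * (x / ‖s‖) ^ 2) = κ ^ 2 * ‖u‖ := by
      simp only [z]
      field_simp
    intro j
    rw [mul_triSlices_mul_transpose]
    push_cast
    rw [hρz, huz, hz, mul_div_cancel₀ _ (pow_ne_zero 2 hz0)]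
    ext a b
    fin_cases j <;> fin_cases a <;> fin_cases b <;> simp [y, ρ] <;> grind

theorem exists_ofSlices_eq_image_triSlices {M : Fin 3 → Matrix (Fin 2) (Fin 2) ℂ}
    (hM : (gram M).det ≠ 0) :
    ∃ (d g : ℝ) (h : ℂ) (B : Matrix (Fin 2) (Fin 2) ℂ), ∃ U ∈ Matrix.unitaryGroup (Fin 3) ℂ,
      0 ≤ d ∧ 0 < g ∧ IsUnit B.det ∧ ofSlices M = image B U (ofSlices (triSlices d g h)) := by
  obtain ⟨Y, hY, hsymm⟩ := exists_forall_isSymm_mul hM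
  have hgram : (gram fun j => M j * Y) = Y.det • gram M := by
    ext i j
    exact polarDet_mul _ _ _
  obtain ⟨U, hU, p, q, r, s, t, u, hp, hs, hu, hmix⟩ := exists_mix_eq_of_isSymm hsymm (by
    rw [hgram, Matrix.det_smul]
    exact mul_ne_zero (pow_ne_zero _ hY) hM)
  obtain ⟨B, e, d, g, h, hB, he, hd, hg, hBe⟩ :=
    exists_smul_eq_mul_triSlices_mul hp hs hu q r t
  have hV : Matrix.diagonal e * U ∈ Matrix.unitaryGroup (Fin 3) ℂ :=
    mul_mem (diagonal_mem_unitaryGroup he) hU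
  have hmixV (j : Fin 3) : mix (Matrix.diagonal e * U) M j = B * triSlices d g h j * (Bᵀ * Y⁻¹) :=
    calc mix (Matrix.diagonal e * U) M j
        = mix (Matrix.diagonal e) (mix U fun j => M j * Y) j * Y⁻¹ := by
          rw [mix_mix, mix_mul, Matrix.mul_nonsing_inv_cancel_right _ _ hY.isUnit]
      _ = B * triSlices d g h j * (Bᵀ * Y⁻¹) := by
          rw [← Matrix.mul_assoc, ← hBe, hmix]
          simp [mix, Matrix.diagonal_apply]
  obtain ⟨V', hV', hMV⟩ := exists_ofSlices_eq_image hV (Equiv.refl _) (by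
    rw [Matrix.det_mul, Matrix.det_transpose, Matrix.det_nonsing_inv]
    exact hB.isUnit.mul hY.isUnit.ringInverse) hmixV
  exact ⟨d, g, h, B, V', hV', hd, hg, hB.isUnit, hMV⟩

end TriSlices

section PartialTranspose

variable {α β : Type*}

/-- The partial transpose of an operator on `α ⊗ β` on the second factor. -/
def partialTranspose (ρ : Matrix (α × β) (α × β) ℂ) : Matrix (α × β) (α × β) ℂ :=
  Matrix.of fun x y => ρ (x.1, y.2) (y.1, x.2)

open scoped ComplexOrder in
theorem IsSeparable.posSemidef_partialTranspose [Finite α] [Finite β]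
    {ρ : Matrix (α × β) (α × β) ℂ} (h : IsSeparable ρ) : (partialTranspose ρ).PosSemidef := by
  obtain ⟨N, μ, ν, rfl⟩ := isSeparable_iff.1 h
  have hsum : partialTranspose (slicesState fun s => Matrix.vecMulVec (μ s) (ν s)) =
      ∑ s, proj fun x => μ s x.1 * star (ν s x.2) := by
    ext x y
    simp only [partialTranspose, proj, Matrix.of_apply, slicesState_apply, Matrix.sum_apply,
      Matrix.vecMulVec_apply, Pi.star_apply, star_mul', star_star]
    exact Finset.sum_congr rfl fun s _ => by ring
  rw [hsum]
  exact Matrix.posSemidef_sum _ fun s _ => Matrix.posSemidef_vecMulVec_self_star _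

end PartialTranspose

section Hermitian

variable {α β : Type*}

theorem IsSeparable.zero : IsSeparable (0 : Matrix (α × β) (α × β) ℂ) :=
  ⟨0, 0, 0, 0, finZeroElim, by simp⟩

theorem IsSeparable.add {ρ σ : Matrix (α × β) (α × β) ℂ} (hρ : IsSeparable ρ)
    (hσ : IsSeparable σ) : IsSeparable (ρ + σ) := by
  obtain ⟨N, q, μ, ν, hq, rfl⟩ := hρ
  obtain ⟨N', q', μ', ν', hq', rfl⟩ := hσ
  refine ⟨N + N', Fin.append q q', Fin.append μ μ', Fin.append ν ν',
    Fin.addCases (fun i => ?_) (fun i => ?_), by simp [Fin.sum_univ_add]⟩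
  · rw [Fin.append_left]
    exact hq i
  · rw [Fin.append_right]
    exact hq' i

theorem exists_eq_smul_proj {μ ν : α → ℂ} (h : (Matrix.vecMulVec μ ν).IsHermitian) :
    ∃ (q : ℝ) (v : α → ℂ), Matrix.vecMulVec μ ν = (q : ℂ) • proj v := by
  have hentry : ∀ a b, star (μ b * ν a) = μ a * ν b := h.apply
  by_cases hν : ν = 0
  · exact ⟨0, 0, by simp [hν]⟩
  obtain ⟨i, hi⟩ := Function.ne_iff.1 hν
  have hi' : (‖ν i‖ : ℂ) ^ 2 ≠ 0 := pow_ne_zero 2 (Complex.ofReal_ne_zero.2 (norm_ne_zero_iff.2 hi))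
  have hreal : ((μ i * ν i).re : ℂ) = μ i * ν i := Complex.conj_eq_iff_re.1 (hentry i i)
  refine ⟨(μ i * ν i).re / ‖ν i‖ ^ 2, star ν, ?_⟩
  ext a b
  have hrow := hentry a i
  have hdiag := hentry i i
  simp only [star_mul', RCLike.star_def] at hrow hdiag
  simp only [proj, Matrix.smul_apply, Matrix.vecMulVec_apply, Pi.star_apply, star_star,
    smul_eq_mul]
  push_cast
  rw [hreal, div_mul_eq_mul_div, eq_div_iff hi', ← Complex.mul_conj', ← hdiag, RCLike.star_def]
  linear_combination -(ν b * (starRingEnd ℂ) (ν i)) * hrow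

theorem isSeparable_kronecker_self {H : Matrix (Fin 2) (Fin 2) ℂ} (hH : H.IsHermitian)
    (hdet : H.det = 0) : IsSeparable (H ⊗ₖ H) := by
  obtain ⟨μ, ν, rfl⟩ := exists_eq_vecMulVec hdet
  obtain ⟨q, v, hqv⟩ := exists_eq_smul_proj hH
  refine ⟨1, fun _ => q ^ 2, fun _ => v, fun _ => v, fun _ => sq_nonneg q, ?_⟩
  rw [hqv, Matrix.smul_kronecker, Matrix.kronecker_smul, smul_smul, Fin.sum_univ_one]
  push_cast
  rw [sq]

theorem exists_sq_add_sq_eq_one_of_mul_nonpos {a e : ℝ} (b : ℝ) (h : a * e ≤ 0) :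
    ∃ c s : ℝ, c ^ 2 + s ^ 2 = 1 ∧ c ^ 2 * a + c * s * b + s ^ 2 * e = 0 := by
  by_cases ha : a = 0
  · exact ⟨1, 0, by norm_num, by simp [ha]⟩
  have hd : 0 ≤ discrim a b e := by
    rw [discrim]
    linarith [sq_nonneg b]
  obtain ⟨r, hr⟩ := exists_quadratic_eq_zero ha ⟨√(discrim a b e), (Real.mul_self_sqrt hd).symm⟩
  have hn : √(r ^ 2 + 1) ^ 2 = r ^ 2 + 1 := Real.sq_sqrt (by positivity)
  refine ⟨r / √(r ^ 2 + 1), 1 / √(r ^ 2 + 1), ?_, ?_⟩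
  · field_simp
    exact hn.symm
  · field_simp
    linear_combination hr

theorem conj_polarDet {H K : Matrix (Fin 2) (Fin 2) ℂ} (hH : H.IsHermitian) (hK : K.IsHermitian) :
    star (polarDet H K) = polarDet H K := by
  simp only [polarDet_apply, star_sub, star_add, star_mul', hH.apply, hK.apply]
  ring

theorem det_re_eq_det {H : Matrix (Fin 2) (Fin 2) ℂ} (hH : H.IsHermitian) :
    (H.det.re : ℂ) = H.det :=
  Complex.conj_eq_iff_re.1 (by rw [← RCLike.star_def, ← Matrix.det_conjTranspose, hH])

theorem det_smul_add_smul (c s : ℂ) (H K : Matrix (Fin 2) (Fin 2) ℂ) :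
    (c • H + s • K).det = c ^ 2 * H.det + c * s * polarDet H K + s ^ 2 * K.det := by
  simp only [Matrix.det_fin_two, polarDet_apply, Matrix.add_apply, Matrix.smul_apply, smul_eq_mul]
  ring

theorem exists_rotation_det_eq_zero {H K : Matrix (Fin 2) (Fin 2) ℂ} (hH : H.IsHermitian)
    (hK : K.IsHermitian) (h : H.det.re * K.det.re ≤ 0) :
    ∃ H' K' : Matrix (Fin 2) (Fin 2) ℂ, H'.IsHermitian ∧ K'.IsHermitian ∧ H'.det = 0 ∧
      K'.det = H.det + K.det ∧ H' ⊗ₖ H' + K' ⊗ₖ K' = H ⊗ₖ H + K ⊗ₖ K := by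
  obtain ⟨c, s, hcs, hroot⟩ := exists_sq_add_sq_eq_one_of_mul_nonpos (polarDet H K).re h
  have hpolar : ((polarDet H K).re : ℂ) = polarDet H K :=
    Complex.conj_eq_iff_re.1 (conj_polarDet hH hK)
  have hcs' : (c : ℂ) ^ 2 + (s : ℂ) ^ 2 = 1 := by exact_mod_cast congrArg Complex.ofReal hcs
  have hroot' : (c : ℂ) ^ 2 * H.det + c * s * polarDet H K + s ^ 2 * K.det = 0 := by
    rw [← det_re_eq_det hH, ← det_re_eq_det hK, ← hpolar]
    exact_mod_cast congrArg Complex.ofReal hroot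
  have hherm (x y : ℝ) : ((x : ℂ) • H + (y : ℂ) • K).IsHermitian :=
    (hH.smul (Complex.conj_ofReal x)).add (hK.smul (Complex.conj_ofReal y))
  refine ⟨(c : ℂ) • H + (s : ℂ) • K, ((-s : ℝ) : ℂ) • H + (c : ℂ) • K, hherm c s, hherm (-s) c,
    ?_, ?_, ?_⟩
  · rw [det_smul_add_smul, hroot']
  · rw [det_smul_add_smul]
    push_cast
    linear_combination (H.det + K.det) * hcs' - hroot'
  · ext ⟨i, j⟩ ⟨k, l⟩
    simp only [Matrix.add_apply, Matrix.kroneckerMap_apply, Matrix.smul_apply, smul_eq_mul]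
    push_cast
    linear_combination (H i k * H j l + K i k * K j l) * hcs'

theorem sum_update_add {ι E F : Type*} [Fintype ι] [DecidableEq ι] [AddCommGroup F] (f : E → F)
    (H : ι → E) (j : ι) (B : E) :
    ∑ i, f (Function.update H j B i) + f (H j) = f B + ∑ i, f (H i) := by
  have hcomp : ∑ i, f (Function.update H j B i) = ∑ i, Function.update (f ∘ H) j (f B) i :=
    Finset.sum_congr rfl fun i _ => congrFun (Function.comp_update f H j B) i
  rw [hcomp, Finset.sum_update_of_mem (Finset.mem_univ j),
    Finset.sum_eq_add_sum_sdiff_singleton_of_mem (Finset.mem_univ j) fun i => f (H i)]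
  simp only [Function.comp_apply]
  abel

theorem exists_mul_nonpos_of_add_sum_eq_zero {ι : Type*} [Fintype ι] {a : ℝ} {b : ι → ℝ}
    (ha : a ≠ 0) (h : a + ∑ j, b j = 0) : ∃ j, a * b j ≤ 0 := by
  by_contra! hpos
  have hsum : 0 ≤ a * ∑ j, b j := by
    rw [Finset.mul_sum]
    exact Finset.sum_nonneg fun j _ => (hpos j).le
  rw [eq_neg_of_add_eq_zero_right h] at hsum
  nlinarith [sq_pos_of_ne_zero ha]

theorem isSeparable_sum_kronecker_self {n : ℕ} {H : Fin n → Matrix (Fin 2) (Fin 2) ℂ}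
    (hH : ∀ i, (H i).IsHermitian) (hdet : ∑ i, (H i).det = 0) :
    IsSeparable (∑ i, H i ⊗ₖ H i) := by
  induction n with
  | zero => simpa using IsSeparable.zero
  | succ n ih =>
    rw [Fin.sum_univ_succ] at hdet ⊢
    by_cases h0 : (H 0).det = 0
    · rw [h0, zero_add] at hdet
      exact (isSeparable_kronecker_self (hH 0) h0).add (ih (fun i => hH i.succ) hdet)
    have hre : (H 0).det.re ≠ 0 := by rwa [← Complex.ofReal_ne_zero, det_re_eq_det (hH 0)]
    obtain ⟨j, hj⟩ := exists_mul_nonpos_of_add_sum_eq_zero (b := fun j : Fin n => (H j.succ).det.re)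
      hre (by simpa using congrArg Complex.re hdet)
    obtain ⟨A, B, hA, hB, hA0, hBdet, hAB⟩ := exists_rotation_det_eq_zero (hH 0) (hH j.succ) hj
    let G : Fin n → Matrix (Fin 2) (Fin 2) ℂ := Function.update (fun i => H i.succ) j B
    have hG : ∀ i, (G i).IsHermitian :=
      (Function.forall_update_iff _ fun _ => Matrix.IsHermitian).2 ⟨hB, fun i _ => hH i.succ⟩
    have hGdet : ∑ i, (G i).det = 0 := by
      linear_combination sum_update_add Matrix.det (fun i => H i.succ) j B + hdet + hBdet
    have hkron : H 0 ⊗ₖ H 0 + ∑ i : Fin n, H i.succ ⊗ₖ H i.succ = A ⊗ₖ A + ∑ i, G i ⊗ₖ G i := by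
      have hG' := sum_update_add (fun X => X ⊗ₖ X) (fun i => H i.succ) j B
      rw [← add_right_cancel_iff (a := H j.succ ⊗ₖ H j.succ), add_right_comm, ← hAB, add_assoc,
        add_assoc, ← hG']
    rw [hkron]
    exact (isSeparable_kronecker_self hA hA0).add (ih hG hGdet)

end Hermitian

section ModelThree

/-- The determinant of the partial transpose of the separability matrix of `triSlices d g h`;
with `h = f e^{iθ}` it is the left-hand side of the inequality defining the third kind of model
space of `ℂ^3 ⊗ ℂ^3`. -/
def triDiscriminant (d g : ℝ) (h : ℂ) : ℝ :=
  (1 - d ^ 2) * (g ^ 2 - (1 - d ^ 2)) - ((1 - d) * h.re) ^ 2 - ((1 + d) * h.im) ^ 2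

theorem triDiscriminant_mul_exp (d f θ g : ℝ) :
    triDiscriminant d g (f * Complex.exp (Complex.I * θ)) = -1 - f ^ 2 + g ^ 2
      - d ^ 2 * (-2 + d ^ 2 + f ^ 2 + g ^ 2) + 2 * d * f ^ 2 * Real.cos (2 * θ) := by
  rw [triDiscriminant, mul_comm Complex.I, Complex.re_ofReal_mul, Complex.exp_ofReal_mul_I_re,
    Complex.im_ofReal_mul, Complex.exp_ofReal_mul_I_im, Real.cos_two_mul]
  linear_combination (-f ^ 2 - d ^ 2 * f ^ 2 - 2 * d * f ^ 2) * Real.sin_sq_add_cos_sq θ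

theorem det_partialTranspose_slicesState_triSlices (d g : ℝ) (h : ℂ) :
    ((partialTranspose (slicesState (triSlices d g h))).submatrix
      (finProdFinEquiv (m := 2) (n := 2)).symm finProdFinEquiv.symm).det =
      triDiscriminant d g h := by
  have hmatrix : (partialTranspose (slicesState (triSlices d g h))).submatrix
      (finProdFinEquiv (m := 2) (n := 2)).symm finProdFinEquiv.symm =
      !![1, 0, 0, 1; 0, 1, (d : ℂ), star h; 0, (d : ℂ), 1, h;
        1, h, star h, (d : ℂ) ^ 2 + h * star h + (g : ℂ) ^ 2] := by
    ext i j
    fin_cases i <;> fin_cases j <;>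
      simp [partialTranspose, slicesState_apply, triSlices, Fin.sum_univ_three, finProdFinEquiv,
        Fin.divNat, Fin.modNat, pow_two]
  have hre : h + star h = 2 * h.re := by simpa using Complex.add_conj h
  have him : h - star h = 2 * h.im * Complex.I := by simpa using Complex.sub_conj h
  have hdet (k : ℂ) : (!![1, 0, 0, 1; 0, 1, (d : ℂ), k; 0, (d : ℂ), 1, h;
      1, h, k, (d : ℂ) ^ 2 + h * k + (g : ℂ) ^ 2]).det =
      (1 - d ^ 2) * (g ^ 2 - (1 - d ^ 2)) - (h - d * k) * (k - d * h) := by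
    simp [Matrix.det_succ_row_zero, Fin.sum_univ_succ, Fin.succAbove]
    ring
  rw [hmatrix, hdet, triDiscriminant]
  push_cast
  linear_combination (-(1 - d) ^ 2 * (h + star h + 2 * h.re) / 4) * hre +
    ((1 + d) ^ 2 * (h - star h + 2 * h.im * Complex.I) / 4) * him +
    ((1 + d) ^ 2 * h.im ^ 2) * Complex.I_sq

open scoped ComplexOrder in
theorem triDiscriminant_nonneg_of_isSeparable {d g : ℝ} {h : ℂ}
    (hs : IsSeparable (slicesState (triSlices d g h))) : 0 ≤ triDiscriminant d g h := by
  have hdet := (hs.posSemidef_partialTranspose.submatrix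
    (finProdFinEquiv (m := 2) (n := 2)).symm).det_nonneg
  rw [det_partialTranspose_slicesState_triSlices] at hdet
  exact_mod_cast hdet

theorem le_one_of_triDiscriminant_nonneg {d g : ℝ} {h : ℂ} (hg : 0 < g)
    (hc : 0 ≤ triDiscriminant d g h) : d ≤ 1 := by
  have hprod : 0 ≤ (1 - d ^ 2) * (g ^ 2 - (1 - d ^ 2)) := by
    rw [triDiscriminant] at hc
    linarith [sq_nonneg ((1 - d) * h.re), sq_nonneg ((1 + d) * h.im)]
  by_contra! hlt
  exact hprod.not_gt (mul_neg_of_neg_of_pos (by nlinarith) (by nlinarith [pow_pos hg 2]))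

theorem exists_coefficients_of_triDiscriminant_nonneg {d g : ℝ} {h : ℂ} (hd : 0 ≤ d) (hg : 0 < g)
    (hc : 0 ≤ triDiscriminant d g h) :
    ∃ α β t t' t'' : ℝ, α ^ 2 = (1 + d) / 2 ∧ β ^ 2 = (1 - d) / 2 ∧ α * t = h.re ∧
      β * t' = -h.im ∧ t ^ 2 + t' ^ 2 + t'' ^ 2 = d ^ 2 + h.re ^ 2 + h.im ^ 2 + g ^ 2 - 1 := by
  have hd1 := le_one_of_triDiscriminant_nonneg hg hc
  have hd2 : 0 < 1 + d := by linarith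
  obtain ⟨t', ht', hpos⟩ : ∃ t' : ℝ, √((1 - d) / 2) * t' = -h.im ∧
      0 ≤ d ^ 2 + h.re ^ 2 + h.im ^ 2 + g ^ 2 - 1 - 2 * h.re ^ 2 / (1 + d) - t' ^ 2 := by
    rcases hd1.eq_or_lt with rfl | hlt
    · have him : h.im = 0 := by
        norm_num [triDiscriminant] at hc
        nlinarith
      refine ⟨0, by simp [him], ?_⟩
      rw [him]
      ring_nf
      positivity
    · have : 0 < 1 - d := by linarith
      have : 0 < √((1 - d) / 2) := Real.sqrt_pos.2 (by linarith)
      refine ⟨-h.im / √((1 - d) / 2), by field_simp, ?_⟩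
      rw [div_pow, Real.sq_sqrt (by linarith)]
      have hquot : d ^ 2 + h.re ^ 2 + h.im ^ 2 + g ^ 2 - 1 - 2 * h.re ^ 2 / (1 + d) -
          (-h.im) ^ 2 / ((1 - d) / 2) = triDiscriminant d g h / ((1 - d) * (1 + d)) := by
        rw [triDiscriminant]
        field_simp
        ring
      rw [hquot]
      positivity
  obtain ⟨t'', ht''⟩ : ∃ t'' : ℝ, t'' ^ 2 = _ := ⟨_, Real.sq_sqrt hpos⟩
  refine ⟨√((1 + d) / 2), √((1 - d) / 2), h.re / √((1 + d) / 2), t', t'',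
    Real.sq_sqrt (by linarith), Real.sq_sqrt (by linarith), by field_simp, ht', ?_⟩
  rw [div_pow, Real.sq_sqrt (by linarith), ht'']
  field_simp
  ring

/-- A family of Hermitian matrices; for suitable parameters the sum of their tensor squares is the
state of `triSlices d g h`. -/
def triHermitian (α β t t' t'' : ℝ) : Fin 4 → Matrix (Fin 2) (Fin 2) ℂ :=
  ![1, !![0, (α : ℂ); (α : ℂ), (t : ℂ)], !![0, β * Complex.I; -(β * Complex.I), (t' : ℂ)],
    !![0, 0; 0, (t'' : ℂ)]]

theorem isHermitian_triHermitian (α β t t' t'' : ℝ) (i : Fin 4) :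
    (triHermitian α β t t' t'' i).IsHermitian := by
  ext a b
  fin_cases i <;> fin_cases a <;> fin_cases b <;> simp [triHermitian]

theorem sum_det_triHermitian (α β t t' t'' : ℝ) :
    ∑ i, (triHermitian α β t t' t'' i).det = ((1 - α ^ 2 - β ^ 2 : ℝ) : ℂ) := by
  simp [triHermitian, Fin.sum_univ_four, Matrix.det_fin_two_of, mul_mul_mul_comm (_ : ℂ) Complex.I]
  ring

theorem slicesState_triSlices_eq_sum {d g α β t t' t'' : ℝ} {h : ℂ} (hα : α ^ 2 = (1 + d) / 2)
    (hβ : β ^ 2 = (1 - d) / 2) (ht : α * t = h.re) (ht' : β * t' = -h.im)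
    (hsum : t ^ 2 + t' ^ 2 + t'' ^ 2 = d ^ 2 + h.re ^ 2 + h.im ^ 2 + g ^ 2 - 1) :
    slicesState (triSlices d g h) =
      ∑ i, triHermitian α β t t' t'' i ⊗ₖ triHermitian α β t t' t'' i := by
  ext ⟨i, j⟩ ⟨k, l⟩
  apply Complex.ext <;> fin_cases i <;> fin_cases j <;> fin_cases k <;> fin_cases l <;>
    simp [slicesState_apply, triSlices, triHermitian, Fin.sum_univ_three, Fin.sum_univ_four,
      Matrix.sum_apply, -Complex.ofReal_mul] <;>
    linarith

theorem isSeparable_triSlices_iff {d g : ℝ} {h : ℂ} (hd : 0 ≤ d) (hg : 0 < g) :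
    IsSeparable (slicesState (triSlices d g h)) ↔ 0 ≤ triDiscriminant d g h := by
  refine ⟨triDiscriminant_nonneg_of_isSeparable, fun hc => ?_⟩
  obtain ⟨α, β, t, t', t'', hα, hβ, ht, ht', hsum⟩ :=
    exists_coefficients_of_triDiscriminant_nonneg hd hg hc
  rw [slicesState_triSlices_eq_sum hα hβ ht ht' hsum]
  refine isSeparable_sum_kronecker_self (isHermitian_triHermitian α β t t' t'') ?_
  rw [sum_det_triHermitian, hα, hβ]
  ring_nf
  simp

/-- The coordinate inclusion `ℂ^2 ⊆ ℂ^3`; it embeds `ofSlices (triSlices d g h)` into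
`ℂ^3 ⊗ ℂ^3` as the third kind of model space. -/
def inclTwoThree : Matrix (Fin 3) (Fin 2) ℂ :=
  !![1, 0; 0, 1; 0, 0]

theorem inclTwoThree_transpose_mul_self : inclTwoThreeᵀ * inclTwoThree = 1 := by
  ext i j
  fin_cases i <;> fin_cases j <;> simp [inclTwoThree, Matrix.mul_apply, Fin.sum_univ_three]

theorem image_inclTwoThree_ofSlices_triSlices (d g : ℝ) (h : ℂ) :
    image inclTwoThree 1 (ofSlices (triSlices d g h)) =
      Submodule.span ℂ {ket (0 : Fin 3) (0 : Fin 3) + ket 1 1,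
        ket 0 1 + ((d : ℂ) • ket 1 0 + h • ket 1 1 + (g : ℂ) • ket 1 2)} := by
  rw [image_ofSlices, ofSlices_fin_two, mix_one]
  congr 2
  · ext ⟨i, j⟩
    fin_cases i <;> fin_cases j <;>
      simp [sliceCol, ket, Matrix.mul_apply, inclTwoThree, triSlices]
  · congr 1
    ext ⟨i, j⟩
    fin_cases i <;> fin_cases j <;>
      simp [sliceCol, ket, Matrix.mul_apply, inclTwoThree, triSlices]

theorem IsModel3.isEB {S : Submodule ℂ (Bip 3 3)} (hS : IsModel3 S) : IsEB S := by
  rcases hS with rfl | rfl | ⟨d, f, θ, g, hd, -, -, hg, hc, rfl⟩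
  · rw [← ofSlices_diagSlices_eq_span_ket]
    exact isEB_ofSlices_vecMulVec _ _
  · rw [← ofSlices_diagSlices_eq_span_ket_add_ket]
    exact isEB_ofSlices_vecMulVec _ _
  · rw [← image_inclTwoThree_ofSlices_triSlices]
    rw [← triDiscriminant_mul_exp] at hc
    exact (isEB_ofSlices.2 ((isSeparable_triSlices_iff hd hg).2 hc)).image _ (one_mem _)

theorem exists_nonneg_eq_norm_mul_exp (h : ℂ) :
    ∃ θ : ℝ, 0 ≤ θ ∧ h = ‖h‖ * Complex.exp (Complex.I * θ) := by
  refine ⟨h.arg + 2 * Real.pi, by linarith [h.neg_pi_lt_arg, Real.pi_pos], ?_⟩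
  push_cast
  rw [mul_comm Complex.I, add_mul, Complex.exp_periodic, Complex.norm_mul_exp_arg_mul_I]

theorem isModel3_image_inclTwoThree {d g : ℝ} {h : ℂ} (hd : 0 ≤ d) (hg : 0 < g)
    (hEB : IsEB (ofSlices (triSlices d g h))) :
    IsModel3 (image inclTwoThree 1 (ofSlices (triSlices d g h))) := by
  obtain ⟨θ, hθ, hh⟩ := exists_nonneg_eq_norm_mul_exp h
  have hc := (isSeparable_triSlices_iff hd hg).1 (isEB_ofSlices.1 hEB)
  rw [hh, triDiscriminant_mul_exp] at hc
  rw [image_inclTwoThree_ofSlices_triSlices]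
  exact Or.inr (Or.inr ⟨d, ‖h‖, θ, g, hd, norm_nonneg h, hθ, hg, hc, by rw [← hh]⟩)

theorem exists_isModel3_ebConvertible_of_det_gram_ne_zero {M : Fin 3 → Matrix (Fin 2) (Fin 2) ℂ}
    (hEB : IsEB (ofSlices M)) (hM : (gram M).det ≠ 0) :
    ∃ S, IsModel3 S ∧ EBConvertible S (ofSlices M) := by
  obtain ⟨d, g, h, B, U, hU, hd, hg, hB, hMT⟩ := exists_ofSlices_eq_image_triSlices hM
  have hUd := isUnit_det_of_mem_unitaryGroup hU
  have hUinv : U⁻¹ ∈ Matrix.unitaryGroup (Fin 3) ℂ := by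
    rw [Matrix.inv_eq_left_inv (Matrix.mem_unitaryGroup_iff'.1 hU)]
    exact Unitary.star_mem hU
  have hT := hEB.image B⁻¹ hUinv
  rw [hMT, image_inv_image hB hUd] at hT
  refine ⟨_, isModel3_image_inclTwoThree hd hg hT, B * inclTwoThreeᵀ, U, hU, ?_⟩
  rw [image_image, Matrix.mul_assoc, inclTwoThree_transpose_mul_self, Matrix.mul_one,
    Matrix.mul_one, hMT]

theorem isEB_iff_exists_model3 {k : ℕ} (hk : k ≤ 3) {T : Submodule ℂ (Bip 2 k)}
    (hT : Module.finrank ℂ T = 2) :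
    IsEB T ↔ ∃ S : Submodule ℂ (Bip 3 3), IsModel3 S ∧ EBConvertible S (T.map (embedB hk)) := by
  rw [← isEB_map_embedB hk]
  constructor
  · intro hEB
    obtain ⟨M, hTM, hLI⟩ := exists_eq_ofSlices (T.map (embedB hk))
      ((T.equivMapOfInjective _ (embedB_injective hk)).finrank_eq.symm.trans hT)
    rw [hTM] at hEB ⊢
    by_cases hdet : (gram M).det = 0
    · obtain ⟨U, hU, hU0⟩ := exists_mix_det_eq_zero_of_three (isEB_ofSlices.1 hEB) hdet
      exact exists_isModel3_ebConvertible_of_mix_det_eq_zero hLI hU hU0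
    · exact exists_isModel3_ebConvertible_of_det_gram_ne_zero hEB hdet
  · rintro ⟨S, hS, W, U, hU, hSW⟩
    rw [hSW]
    exact hS.isEB.image W hU

end ModelThree

end EBSpace

theorem mainTheorem3 :
    -- reduction to `ℂ^2 ⊗ ℂ^k` with `k = 2, 3, 4`, where `k` is the local rank on `B`
    (∀ (n : ℕ) (V : Submodule ℂ (EBSpace.Bip 2 n)),
      Module.finrank ℂ V = 2 → EBSpace.IsEB V →
      ∃ k : ℕ, (k = 2 ∨ k = 3 ∨ k = 4) ∧ ∃ (hk : k ≤ n) (T : Submodule ℂ (EBSpace.Bip 2 k)),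
        EBSpace.IsEB T ∧ EBSpace.rankB T = k ∧
        EBSpace.LUEquivalent V (T.map (EBSpace.embedB hk))) ∧
    -- `k = 2, 3`
    (∀ (k : ℕ) (hk : k ≤ 3) (T : Submodule ℂ (EBSpace.Bip 2 k)),
      (k = 2 ∨ k = 3) → Module.finrank ℂ T = 2 →
      (EBSpace.IsEB T ↔
        ∃ S : Submodule ℂ (EBSpace.Bip 3 3), EBSpace.IsModel3 S ∧
          EBSpace.EBConvertible S (T.map (EBSpace.embedB hk)))) ∧
    -- `k = 4`
    (∀ T : Submodule ℂ (EBSpace.Bip 2 4),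
      (Module.finrank ℂ T = 2 ∧ EBSpace.IsEB T ∧ EBSpace.rankB T = 4) ↔
        ∃ a b c d : Fin 2 → ℂ,
          Matrix.det !![a 0 * b 1, a 1 * b 0; c 0 * d 1, c 1 * d 0] ≠ 0 ∧
          EBSpace.EBEquivalent (EBSpace.model4 a b c d) T) := by
  refine ⟨fun n V hV hEB => ?_, fun _ hk _ _ hT => EBSpace.isEB_iff_exists_model3 hk hT,
    EBSpace.isEB_rankB_four_iff⟩
  have hlower := hEB.finrank_le_rankB
  have hupper := EBSpace.rankB_le_mul_finrank V
  obtain ⟨T, hT, hrank, hLU⟩ := EBSpace.exists_luEquivalent hEB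
  exact ⟨EBSpace.rankB V, by lia, EBSpace.rankB_le V, T, hT, hrank, hLU⟩
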